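/- Let $(\mathbb{k},\mathbb{K})$ be $(\mathbb{R},\mathbb{R})$, $(\mathbb{R},\mathbb{C})$ or $(\mathbb{C},\mathbb{C})$; $\mathbb{k}$ is the field of scalars of the source space (and of the derivative parameters) and $\mathbb{K}$ is the field in which functionals take their values. **(a) Equicontinuity.** Let $E$ be a Fréchet space over $\mathbb{k}$, $U\subset E$ open, $k\ge 0$, and let $F:U\times E^k\to\mathbb{K}$ be continuous and $\mathbb{k}$-multilinear in the last $k$ variables. Let $E^{\hat\otimes_\pi k}$ be the completed projective tensor power, i.e. the completion of $E^{\otimes k}$ for the topology defined by the seminorms $p_1\otimes\dots\otimes p_k(\psi)=\inf\sum_n |a_n|\,p_1(e_{1,n})\cdots p_k(e_{k,n})$, the infimum being over all representations of $\psi$ as a finite sum $\psi=\sum_n a_n\,e_{1,n}\otimes\dots\otimes e_{k,n}$, where the $p_i$ are continuous seminorms of $E$. Then for each $\varphi\in U$ there is a unique continuous linear $\bar F(\varphi,\cdot):E^{\hat\otimes_\pi k}\to\mathbb{K}$ with $\bar F(\varphi,e_1\otimes\dots\otimes e_k)=F(\varphi,e_1,\dots,e_k)$ for all $e_1,\dots,e_k\in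 E$, and for every $\varphi_0\in U$ there are a neighbourhood $V\subset U$ of $\varphi_0$, a continuous seminorm $q$ on $E^{\hat\otimes_\pi k}$ and a constant $C>0$ such that $$|\bar F(\varphi,\psi)-\bar F(\varphi_0,\psi)|\le C\,q(\psi)\qquad\text{for all }\varphi\in V,\ \psi\in E^{\hat\otimes_\pi k}.$$ **(b) Locally bounded order.** Let $M$ be a smooth, Hausdorff, paracompact manifold of dimension $d\ge 0$ (without boundary), and let $C^\infty(M)$ be the space of smooth $\mathbb{k}$-valued functions on $M$ with its usual topology (uniform convergence of all derivatives on compact subsets of charts). Let $U\subset C^\infty(M)$ be open and let $F:U\to\mathbb{K}$ be smooth in the sense of Bastiani: for every $k\ge 0$ the Gâteaux differential $D^kF_\varphi(v_1,\dots,v_k)=\frac{\partial^k}{\partial t_1\cdots\partial t_k}F(\varphi+t_1v_1+\dots+t_kv_k)\big|_{t=0}$ exists for all $\varphi\in U$ and $v_i\in C^\infty(M)$, and $D^kF:U\times C^\infty(M)^k\to\mathbb{K}$ is continuous. Then for every $\varphi_0\in U$ and every integer $k\ge 0$ there are a neighbourhood $V\subset U$ of $\varphi_0$, an integer $m\ge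 0$ and a compact set $K\subset M^k$ such that for every $\varphi\in V$: there is a unique compactly supported distribution $F^{(k)}_\varphi\in\mathcal{E}'(M^k)$, i.e. a unique continuous $\mathbb{k}$-linear map $F^{(k)}_\varphi:C^\infty(M^k)\to\mathbb{K}$, with $F^{(k)}_\varphi(v_1\otimes\dots\otimes v_k)=D^kF_\varphi(v_1,\dots,v_k)$ for all $v_1,\dots,v_k\in C^\infty(M)$; the order of $F^{(k)}_\varphi$ is at most $m$; and $F^{(k)}_\varphi$ is supported in $K$. Here a compactly supported distribution has order at most $m$ if it is bounded by a constant times a finite sum of $C^m$-seminorms over compact subsets of charts. -/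

import Mathlib

open scoped Manifold ContDiff Topology TensorProduct

noncomputable section

/-! ### Finite products of manifolds -/

instance ModelWithCorners.pi_boundaryless {ι : Type*} [Fintype ι]
    {E : ι → Type*} [∀ i, NormedAddCommGroup (E i)] [∀ i, NormedSpace ℝ (E i)]
    {H : ι → Type*} [∀ i, TopologicalSpace (H i)] (I : ∀ i, ModelWithCorners ℝ (E i) (H i))
    [∀ i, (I i).Boundaryless] : (ModelWithCorners.pi I).Boundaryless := by
  refine ⟨?_⟩
  refine Set.eq_univ_of_forall fun y => ?_
  have h : ∀ i, ∃ x, I i x = y i := fun i => by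
    have : y i ∈ Set.range (I i) := by rw [(I i).range_eq_univ]; trivial
    exact this
  choose x hx using h
  exact ⟨x, funext hx⟩

/-- A finite product of smooth manifolds is a smooth manifold for the product charts. -/
instance IsManifold.pi_isManifold {ι : Type*} [Fintype ι]
    {E : ι → Type*} [∀ i, NormedAddCommGroup (E i)] [∀ i, NormedSpace ℝ (E i)]
    {H : ι → Type*} [∀ i, TopologicalSpace (H i)] (I : ∀ i, ModelWithCorners ℝ (E i) (H i))
    (M : ι → Type*) [∀ i, TopologicalSpace (M i)] [∀ i, ChartedSpace (H i) (M i)]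
    [∀ i, IsManifold (I i) ∞ (M i)] : IsManifold (ModelWithCorners.pi I) ∞ (∀ i, M i) := by
  refine isManifold_of_contDiffOn _ _ _ ?_
  rintro _ _ ⟨e, he, rfl⟩ ⟨e', he', rfl⟩
  have key : ∀ i, ContDiffOn ℝ ∞ (I i ∘ ((e i).symm ≫ₕ e' i) ∘ (I i).symm)
      ((I i).symm ⁻¹' ((e i).symm ≫ₕ e' i).source ∩ Set.range (I i)) := fun i =>
    (contDiffGroupoid ∞ (I i)).compatible (he i trivial) (he' i trivial) |>.1
  rw [contDiffOn_pi]
  intro i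
  have hp : ContDiffOn ℝ ∞ (fun y : ∀ i, E i => y i)
      ((ModelWithCorners.pi I).symm ⁻¹' ((OpenPartialHomeomorph.pi e).symm ≫ₕ
        OpenPartialHomeomorph.pi e').source ∩ Set.range (ModelWithCorners.pi I)) :=
    (ContinuousLinearMap.proj (R := ℝ) (φ := E) i).contDiff.contDiffOn
  refine (key i).comp hp ?_
  rintro y ⟨⟨h1, h2⟩, ⟨z, rfl⟩⟩
  exact ⟨⟨h1 i trivial, h2 i trivial⟩, ⟨z i, rfl⟩⟩

/-- The `i`-th projection `M^k → M` is smooth. -/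
theorem contMDiff_pi_eval {ι : Type*} [Fintype ι]
    {E : ι → Type*} [∀ i, NormedAddCommGroup (E i)] [∀ i, NormedSpace ℝ (E i)]
    {H : ι → Type*} [∀ i, TopologicalSpace (H i)] (I : ∀ i, ModelWithCorners ℝ (E i) (H i))
    (M : ι → Type*) [∀ i, TopologicalSpace (M i)] [∀ i, ChartedSpace (H i) (M i)]
    [∀ i, IsManifold (I i) ∞ (M i)] (i : ι) :
    ContMDiff (ModelWithCorners.pi I) (I i) ∞ (fun x : ∀ i, M i => x i) := by
  intro x
  rw [contMDiffAt_iff]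
  refine ⟨(continuous_apply i).continuousAt, ?_⟩
  have h : ContDiffWithinAt ℝ ∞ (fun y : ∀ i, E i => y i)
      (Set.range (ModelWithCorners.pi I)) (extChartAt (ModelWithCorners.pi I) x x) :=
    (ContinuousLinearMap.proj (R := ℝ) (φ := E) i).contDiff.contDiffWithinAt
  refine h.congr_of_eventuallyEq ?_ ?_
  · have mem_target : ∀ {y : ∀ i, E i},
        y ∈ (extChartAt (ModelWithCorners.pi I) x).target →
          y i ∈ (extChartAt (I i) (x i)).target := by
      intro y hy
      rw [extChartAt_target] at hy ⊢
      refine ⟨hy.1 i trivial, ?_⟩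
      obtain ⟨z, rfl⟩ := hy.2
      exact ⟨z i, rfl⟩
    filter_upwards [extChartAt_target_mem_nhdsWithin (I := ModelWithCorners.pi I) x] with y hy
    exact (extChartAt (I i) (x i)).right_inv (mem_target hy)
  · exact (extChartAt (I i) (x i)).right_inv ((extChartAt (I i) (x i)).map_source
      (mem_extChartAt_source (x i)))

/-! ### The space of smooth functions on a manifold -/

section SmoothFn

variable (𝕜 : Type*) [RCLike 𝕜] {V : Type*} [NormedAddCommGroup V] [NormedSpace ℝ V]
  {H : Type*} [TopologicalSpace H] (I : ModelWithCorners ℝ V H)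
  (N : Type*) [TopologicalSpace N] [ChartedSpace H N]

/-- The `𝕜`-valued smooth functions on `N`, as a subspace of all functions. -/
def smoothSubmodule : Submodule 𝕜 (N → 𝕜) where
  carrier := {f | ContMDiff I 𝓘(ℝ, 𝕜) ∞ f}
  add_mem' hf hg := ContMDiff.add hf hg
  zero_mem' := contMDiff_const
  smul_mem' c f hf := by
    have h : ContDiff ℝ ∞ (fun z : 𝕜 => c * z) := contDiff_const.mul contDiff_id
    exact h.contMDiff.comp hf

/-- The space `C^∞(N)` of `𝕜`-valued smooth functions on the manifold `N`. It is a type of its own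
so that it does not inherit the topology of pointwise convergence. -/
def SmoothFn : Type _ := smoothSubmodule 𝕜 I N

instance : AddCommGroup (SmoothFn 𝕜 I N) := inferInstanceAs (AddCommGroup (smoothSubmodule 𝕜 I N))

instance : Module 𝕜 (SmoothFn 𝕜 I N) := inferInstanceAs (Module 𝕜 (smoothSubmodule 𝕜 I N))

instance : CoeFun (SmoothFn 𝕜 I N) (fun _ => N → 𝕜) := ⟨fun f => f.1⟩

variable {𝕜 I N}

theorem SmoothFn.contMDiff (f : SmoothFn 𝕜 I N) : ContMDiff I 𝓘(ℝ, 𝕜) ∞ f := f.2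

@[simp] theorem SmoothFn.add_apply (f g : SmoothFn 𝕜 I N) (x : N) : (f + g) x = f x + g x := rfl

@[simp] theorem SmoothFn.smul_apply (c : 𝕜) (f : SmoothFn 𝕜 I N) (x : N) :
    (c • f) x = c * f x := rfl

variable (I N) in
/-- A compact set contained in the (image of the) domain of a chart of `N`. -/
structure ChartCompact where
  /-- the point at which the chart is centred -/
  pt : N
  /-- the compact set, in coordinates -/
  carrier : Set V
  isCompact : IsCompact carrier
  subset : carrier ⊆ (extChartAt I pt).target

variable [I.Boundaryless] [IsManifold I ∞ N]

/-- The expression of `f` in the chart around `x`. -/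
def SmoothFn.inChart (f : SmoothFn 𝕜 I N) (x : N) : V → 𝕜 := f ∘ (extChartAt I x).symm

theorem SmoothFn.contDiffAt_inChart (f : SmoothFn 𝕜 I N) (x : N) {y : V}
    (hy : y ∈ (extChartAt I x).target) : ContDiffAt ℝ ∞ (f.inChart x) y := by
  have h1 : ContMDiffOn 𝓘(ℝ, V) I ∞ (extChartAt I x).symm (extChartAt I x).target :=
    contMDiffOn_extChartAt_symm x
  have h2 : ContMDiffOn 𝓘(ℝ, V) 𝓘(ℝ, 𝕜) ∞ (f.inChart x) (extChartAt I x).target :=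
    f.contMDiff.comp_contMDiffOn h1
  exact h2.contDiffOn.contDiffAt ((isOpen_extChartAt_target x).mem_nhds hy)

theorem SmoothFn.continuousOn_norm_iteratedFDeriv (f : SmoothFn 𝕜 I N) (c : ChartCompact I N)
    (j : ℕ) : ContinuousOn (fun y => ‖iteratedFDeriv ℝ j (f.inChart c.pt) y‖) c.carrier := by
  intro y hy
  exact (((f.contDiffAt_inChart c.pt (c.subset hy)).continuousAt_iteratedFDeriv
    (by exact_mod_cast le_top)).norm).continuousWithinAt

theorem SmoothFn.bddAbove (f : SmoothFn 𝕜 I N) (c : ChartCompact I N) (j : ℕ) :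
    BddAbove (Set.range fun y : c.carrier => ‖iteratedFDeriv ℝ j (f.inChart c.pt) y‖) := by
  have := c.isCompact.bddAbove_image (f.continuousOn_norm_iteratedFDeriv c j)
  rwa [Set.image_eq_range] at this

/-- `sup_{y ∈ K} ‖D^j f (y)‖`, in a chart. -/
def derivSeminorm (c : ChartCompact I N) (j : ℕ) : Seminorm 𝕜 (SmoothFn 𝕜 I N) :=
  Seminorm.ofSMulLE (fun f => ⨆ y : c.carrier, ‖iteratedFDeriv ℝ j (f.inChart c.pt) y‖)
    (by
      have h : ∀ (x : N) (j : ℕ), iteratedFDeriv ℝ j ((0 : SmoothFn 𝕜 I N).inChart x) = 0 := by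
        intro x j
        have : (0 : SmoothFn 𝕜 I N).inChart x = fun _ => (0 : 𝕜) := rfl
        rw [this]
        exact iteratedFDeriv_fun_zero
      simp [h])
    (fun f g => by
      refine Real.iSup_le (fun y => ?_) ?_
      · have hf := (f.contDiffAt_inChart c.pt (c.subset y.2)).of_le
          (show (j : WithTop ℕ∞) ≤ ∞ by exact_mod_cast le_top)
        have hg := (g.contDiffAt_inChart c.pt (c.subset y.2)).of_le
          (show (j : WithTop ℕ∞) ≤ ∞ by exact_mod_cast le_top)
        have h : iteratedFDeriv ℝ j ((f + g).inChart c.pt) y =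
            iteratedFDeriv ℝ j (f.inChart c.pt) y + iteratedFDeriv ℝ j (g.inChart c.pt) y :=
          iteratedFDeriv_add_apply hf hg
        rw [h]
        exact (norm_add_le _ _).trans
          (add_le_add (le_ciSup (f.bddAbove c j) y) (le_ciSup (g.bddAbove c j) y))
      · exact add_nonneg (Real.iSup_nonneg fun _ => norm_nonneg _)
          (Real.iSup_nonneg fun _ => norm_nonneg _))
    (fun r f => by
      refine Real.iSup_le (fun y => ?_) ?_
      · have hf := (f.contDiffAt_inChart c.pt (c.subset y.2)).of_le
          (show (j : WithTop ℕ∞) ≤ ∞ by exact_mod_cast le_top)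
        have h : iteratedFDeriv ℝ j ((r • f).inChart c.pt) y =
            r • iteratedFDeriv ℝ j (f.inChart c.pt) y :=
          iteratedFDeriv_const_smul_apply hf
        rw [h, norm_smul]
        exact mul_le_mul_of_nonneg_left (le_ciSup (f.bddAbove c j) y) (norm_nonneg _)
      · exact mul_nonneg (norm_nonneg _) (Real.iSup_nonneg fun _ => norm_nonneg _))

/-- The seminorm `π_{m,K}(f) = sup_{y ∈ K} sup_{j ≤ m} ‖D^j f (y)‖`, in a chart. -/
def chartSeminorm (c : ChartCompact I N) (m : ℕ) : Seminorm 𝕜 (SmoothFn 𝕜 I N) :=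
  (Finset.range (m + 1)).sup fun j => derivSeminorm c j

/-- The usual topology of `C^∞(N)`: uniform convergence of all derivatives on the compact
subsets of the charts, that is, the topology defined by all the seminorms `π_{m,K}`. -/
instance SmoothFn.instTopologicalSpace : TopologicalSpace (SmoothFn 𝕜 I N) :=
  ⨅ i : ChartCompact I N × ℕ,
    (chartSeminorm (𝕜 := 𝕜) i.1 i.2).toSeminormedAddCommGroup.toUniformSpace.toTopologicalSpace

/-! ### Compactly supported distributions -/

variable {𝕂 : Type*} [RCLike 𝕂] [NormedAlgebra 𝕜 𝕂]

/-- The compactly supported distribution `u` has order at most `m`: it is continuous for the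
`C^m`-seminorms on a compact set (a finite union of compact subsets of charts). -/
def HasOrderAtMost (u : SmoothFn 𝕜 I N →L[𝕜] 𝕂) (m : ℕ) : Prop :=
  ∃ (s : Finset (ChartCompact I N)) (C : ℝ), ∀ ψ : SmoothFn 𝕜 I N,
    ‖u ψ‖ ≤ C * ∑ c ∈ s, chartSeminorm c m ψ

/-- The order of a compactly supported distribution: the least `m` such that it has order at
most `m` (and `⊤` if there were none). -/
def distOrder (u : SmoothFn 𝕜 I N →L[𝕜] 𝕂) : ℕ∞ :=
  ⨅ (m : ℕ) (_ : HasOrderAtMost u m), (m : ℕ∞)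

/-- The support of a distribution: the complement of the largest open set such that `u`
vanishes on the test functions supported in it. -/
def distSupport (u : SmoothFn 𝕜 I N →L[𝕜] 𝕂) : Set N :=
  {x | ∀ O : Set N, IsOpen O → x ∈ O → ∃ ψ : SmoothFn 𝕜 I N,
    HasCompactSupport (ψ : N → 𝕜) ∧ tsupport (ψ : N → 𝕜) ⊆ O ∧ u ψ ≠ 0}

end SmoothFn

/-! ### External tensor products of smooth functions -/

section Tensor

variable {𝕜 : Type*} [RCLike 𝕜] {V : Type*} [NormedAddCommGroup V] [NormedSpace ℝ V]
  {H : Type*} [TopologicalSpace H] {I : ModelWithCorners ℝ V H}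
  {N : Type*} [TopologicalSpace N] [ChartedSpace H N] [IsManifold I ∞ N]

/-- `v₁ ⊗ ⋯ ⊗ v_k ∈ C^∞(N^k)`, the function `(x₁, …, x_k) ↦ v₁(x₁) ⋯ v_k(x_k)`. -/
def SmoothFn.tensor {k : ℕ} (v : Fin k → SmoothFn 𝕜 I N) :
    SmoothFn 𝕜 (ModelWithCorners.pi fun _ : Fin k => I) (Fin k → N) :=
  ⟨fun x => ∏ i, v i (x i), by
    have h : ∀ i, ContMDiff (ModelWithCorners.pi fun _ : Fin k => I) 𝓘(ℝ, 𝕜) ∞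
        (fun x : Fin k → N => v i (x i)) := fun i =>
      (v i).contMDiff.comp (contMDiff_pi_eval (fun _ => I) (fun _ => N) i)
    have hp : ContDiff ℝ ∞ (fun z : Fin k → 𝕜 => ∏ i, z i) :=
      contDiff_prod fun i _ => (ContinuousLinearMap.proj (R := ℝ) (φ := fun _ : Fin k => 𝕜) i).contDiff
    exact hp.contMDiff.comp (contMDiff_pi_space.2 h)⟩

end Tensor

/-! ### Smooth functionals in the sense of Bastiani -/

section Bastiani

variable (𝕜 : Type*) [RCLike 𝕜] {E : Type*} [AddCommGroup E] [Module 𝕜 E]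
  {𝕂 : Type*} [RCLike 𝕂] [NormedAlgebra 𝕜 𝕂]

/-- The `k`-th Gâteaux differential
`D^k F_x(v₁, …, v_k) = ∂^k F(x + t₁ v₁ + ⋯ + t_k v_k) / ∂t₁ ⋯ ∂t_k` at `t = 0`:
differentiate first in the direction `v_k`, then `v_{k-1}`, and so on up to `v₁`. -/
def gateauxDiff (F : E → 𝕂) : (k : ℕ) → E → (Fin k → E) → 𝕂
  | 0, x, _ => F x
  | k + 1, x, v => lineDeriv 𝕜 (fun y => gateauxDiff F k y (Fin.tail v)) x (v 0)

/-- `F` is `k` times Bastiani differentiable on `U`: its iterated directional derivatives up to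
order `k` exist at every point of `U`, in all directions, and `D^k F` is continuous on
`U × E^k`. -/
def BastianiDiffOn [TopologicalSpace E] (k : ℕ) (F : E → 𝕂) (U : Set E) : Prop :=
  (∀ j < k, ∀ x ∈ U, ∀ v : Fin (j + 1) → E,
    LineDifferentiableAt 𝕜 (fun y => gateauxDiff 𝕜 F j y (Fin.tail v)) x (v 0)) ∧
  ContinuousOn (fun p : E × (Fin k → E) => gateauxDiff 𝕜 F k p.1 p.2) (U ×ˢ Set.univ)

/-- `F` is smooth on `U` in the sense of Bastiani. -/
def BastianiSmoothOn [TopologicalSpace E] (F : E → 𝕂) (U : Set E) : Prop :=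
  ∀ k : ℕ, BastianiDiffOn 𝕜 k F U

end Bastiani

section Kernel

variable {𝕜 : Type*} [RCLike 𝕜] {V : Type*} [NormedAddCommGroup V] [NormedSpace ℝ V]
  {H : Type*} [TopologicalSpace H] {I : ModelWithCorners ℝ V H} [I.Boundaryless]
  {N : Type*} [TopologicalSpace N] [ChartedSpace H N] [IsManifold I ∞ N]
  {𝕂 : Type*} [RCLike 𝕂] [NormedAlgebra 𝕜 𝕂]

/-- `u = F^{(k)}_φ`: the compactly supported distribution `u` on `N^k` satisfies
`u(v₁ ⊗ ⋯ ⊗ v_k) = D^k F_φ(v₁, …, v_k)`. -/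
def IsDerivKernel (F : SmoothFn 𝕜 I N → 𝕂) (k : ℕ) (φ : SmoothFn 𝕜 I N)
    (u : SmoothFn 𝕜 (ModelWithCorners.pi fun _ : Fin k => I) (Fin k → N) →L[𝕜] 𝕂) : Prop :=
  ∀ v : Fin k → SmoothFn 𝕜 I N, u (SmoothFn.tensor v) = gateauxDiff 𝕜 F k φ v

end Kernel

/-! ### The completed projective tensor power -/

section Projective

variable (𝕜 : Type*) [RCLike 𝕜] (E : Type*) [AddCommGroup E] [Module 𝕜 E] (k : ℕ)

variable {𝕜 E k}

/-- The cost `∑ ‖a‖ p₁(e₁) ⋯ p_k(e_k)` of a formal sum of terms `a • e₁ ⊗ ⋯ ⊗ e_k`. -/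
def tensorCost (p : Fin k → Seminorm 𝕜 E) (r : FreeAddMonoid (𝕜 × (Fin k → E))) : ℝ :=
  (r.toList.map fun a => ‖a.1‖ * ∏ i, p i (a.2 i)).sum

theorem tensorCost_nonneg (p : Fin k → Seminorm 𝕜 E) (r : FreeAddMonoid (𝕜 × (Fin k → E))) :
    0 ≤ tensorCost p r := by
  refine List.sum_nonneg fun a ha => ?_
  simp only [List.mem_map] at ha
  obtain ⟨b, -, rfl⟩ := ha
  exact mul_nonneg (norm_nonneg _) (Finset.prod_nonneg fun i _ => apply_nonneg _ _)

theorem tensorCost_bddBelow (p : Fin k → Seminorm 𝕜 E) (ψ : ⨂[𝕜] _ : Fin k, E) :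
    BddBelow (Set.range fun r : PiTensorProduct.lifts ψ => tensorCost p r.1) :=
  ⟨0, by rintro _ ⟨r, rfl⟩; exact tensorCost_nonneg p r.1⟩

instance (ψ : ⨂[𝕜] _ : Fin k, E) : Nonempty (PiTensorProduct.lifts ψ) :=
  (PiTensorProduct.nonempty_lifts ψ).to_subtype

/-- The seminorm `p₁ ⊗ ⋯ ⊗ p_k` on `E^{⊗k}`: the infimum of `∑ₙ ‖aₙ‖ p₁(e_{1,n}) ⋯ p_k(e_{k,n})`
over all representations `ψ = ∑ₙ aₙ • e_{1,n} ⊗ ⋯ ⊗ e_{k,n}` as a finite sum. -/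
def projSeminorm (p : Fin k → Seminorm 𝕜 E) : Seminorm 𝕜 (⨂[𝕜] _ : Fin k, E) :=
  Seminorm.ofSMulLE
    (fun ψ : ⨂[𝕜] _ : Fin k, E => ⨅ r : PiTensorProduct.lifts ψ, tensorCost p r.1)
    (le_antisymm (ciInf_le (tensorCost_bddBelow p _) ⟨0, PiTensorProduct.lifts_zero⟩)
      (le_ciInf fun r => tensorCost_nonneg p r.1))
    (fun ψ χ => le_ciInf_add_ciInf fun r s =>
      ciInf_le_of_le (tensorCost_bddBelow p _) ⟨r.1 + s.1, PiTensorProduct.lifts_add r.2 s.2⟩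
        (by simp [tensorCost]))
    (fun a ψ => by
      rw [Real.mul_iInf_of_nonneg (norm_nonneg _)]
      refine le_ciInf fun r => ?_
      refine ciInf_le_of_le (tensorCost_bddBelow p _) ⟨_, PiTensorProduct.lifts_smul r.2 a⟩ ?_
      simp [tensorCost, Function.comp_def, mul_assoc, List.sum_map_mul_left])

variable (𝕜 E k)

/-- The algebraic tensor power `E^{⊗k}`; a type of its own, to carry the projective topology. -/
def ProjTensor : Type _ := ⨂[𝕜] _ : Fin k, E

instance : AddCommGroup (ProjTensor 𝕜 E k) := inferInstanceAs (AddCommGroup (⨂[𝕜] _ : Fin k, E))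

instance : Module 𝕜 (ProjTensor 𝕜 E k) := inferInstanceAs (Module 𝕜 (⨂[𝕜] _ : Fin k, E))

/-- The identity map from `E^{⊗k}` with the projective topology to the bare tensor power. -/
def ProjTensor.toTensor : ProjTensor 𝕜 E k ≃ₗ[𝕜] ⨂[𝕜] _ : Fin k, E := LinearEquiv.refl 𝕜 _

variable {𝕜 E k}

/-- The seminorm `p₁ ⊗ ⋯ ⊗ p_k` on the type carrying the projective topology. -/
def ProjTensor.seminorm (p : Fin k → Seminorm 𝕜 E) : Seminorm 𝕜 (ProjTensor 𝕜 E k) :=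
  (projSeminorm p).comp (ProjTensor.toTensor 𝕜 E k).toLinearMap

variable [TopologicalSpace E]

/-- The projective topology (as a uniform structure) on `E^{⊗k}`, defined by the seminorms
`p₁ ⊗ ⋯ ⊗ p_k`, where each `pᵢ` runs over the continuous seminorms of `E`. -/
instance ProjTensor.instUniformSpace : UniformSpace (ProjTensor 𝕜 E k) :=
  ⨅ p : Fin k → {p : Seminorm 𝕜 E // Continuous p},
    (ProjTensor.seminorm fun i => (p i).1).toSeminormedAddCommGroup.toUniformSpace

instance : IsUniformAddGroup (ProjTensor 𝕜 E k) :=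
  isUniformAddGroup_iInf fun p =>
    letI := (ProjTensor.seminorm fun i => (p i).1).toSeminormedAddCommGroup
    inferInstance

instance : UniformContinuousConstSMul 𝕜 (ProjTensor 𝕜 E k) := by
  refine ⟨fun c => uniformContinuous_iInf_rng.2 fun p => uniformContinuous_iInf_dom (i := p) ?_⟩
  let _ : SeminormedAddCommGroup (ProjTensor 𝕜 E k) :=
    (ProjTensor.seminorm fun i => (p i).1).toSeminormedAddCommGroup
  let _ : NormedSpace 𝕜 (ProjTensor 𝕜 E k) :=
    ⟨fun a x => (map_smul_eq_mul (ProjTensor.seminorm fun i => (p i).1) a x).le⟩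
  exact uniformContinuous_const_smul c

variable (𝕜 E k) in
/-- The completed projective tensor power of `E`. -/
abbrev CompletedTensor : Type _ := UniformSpace.Completion (ProjTensor 𝕜 E k)

/-- `e₁ ⊗ ⋯ ⊗ e_k` as an element of the completed projective tensor power. -/
def completedTprod (e : Fin k → E) : CompletedTensor 𝕜 E k :=
  UniformSpace.Completion.coe' ((ProjTensor.toTensor 𝕜 E k).symm (PiTensorProduct.tprod 𝕜 e))

end Projective

end

open scoped Manifold ContDiff Topology TensorProduct

noncomputable section

/-! ### Cosine series on the unit cube -/

section Cosine

open MeasureTheory Filter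

variable {ι : Type*} [Fintype ι]

/-! Both parts rest on one remark. A family that is jointly continuous at `(φ₀, 0)` and multilinear
in its last `k` variables is bounded near `(φ₀, 0)`. By homogeneity this becomes `‖F φ v‖ ≤ C * ∏ i,
p (v i)`, with one continuous seminorm `p` and one constant `C` for all `φ` near `φ₀`
(`exists_seminorm_bound_of_continuousAt`).

For (a), the bound passes to the projective seminorm, because it can be applied to each
representation of a tensor, and then to the completion by density. Estimating the two terms of the
difference separately gives the constant `2C`.

For (b), Bastiani smoothness makes `D^k F_φ` multilinear (`gateauxDiff_update`), and `p` is
dominated by finitely many `C^m`-seminorms on compact subsets of charts. What remains is a Schwartz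
kernel theorem whose order and support depend only on these seminorms (`exists_kernel`). Cut-off
functions reduce it to functions supported in the unit cube of a chart, which are expanded in cosine
series; cosines are real, so they serve real and complex scalars alike. The coefficients of a smooth
function decay faster than any power of the frequency, while the `C^m`-seminorms of the cosine
products grow at most like its `m`-th power. On `M^k` the cut-off cosine products are elementary
tensors, on which the values of the kernel are prescribed; the sum of coefficients times prescribed
values converges absolutely and is bounded by finitely many derivatives of the test function. The
same expansion shows that a distribution is determined by its values on tensors
(`eq_zero_of_forall_tensor_eq_zero`), whence uniqueness. -/

theorem prod_univ_le_pow_card {f : ι → ℝ} {c : ℝ} (h0 : ∀ j, 0 ≤ f j) (h : ∀ j, f j ≤ c) :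
    ∏ j, f j ≤ c ^ Fintype.card ι := by
  calc ∏ j, f j ≤ ∏ _j : ι, c := Finset.prod_le_prod (fun j _ => h0 j) fun j _ => h j
    _ = c ^ Fintype.card ι := by rw [Finset.prod_const, Finset.card_univ]

/-- The cosine product `x ↦ ∏ⱼ cos (π nⱼ xⱼ)`. -/
def cosBasis (n : ι → ℕ) (x : ι → ℝ) : ℝ := ∏ j, Real.cos (Real.pi * n j * x j)

/-- The closed unit cube. -/
def unitCube (ι : Type*) : Set (ι → ℝ) := Set.univ.pi fun _ => Set.Icc 0 1

/-- The weight `1 + ∑ⱼ nⱼ`. -/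
def freqWeight (n : ι → ℕ) : ℝ := 1 + ∑ j, (n j : ℝ)

/-- The normalising factor of the cosine product: `1 / ∫ (cosBasis n)²`. -/
def cosNormalizer (n : ι → ℕ) : ℝ := ∏ j, if n j = 0 then 1 else 2

theorem one_le_freqWeight (n : ι → ℕ) : 1 ≤ freqWeight n :=
  le_add_of_nonneg_right (Finset.sum_nonneg fun _ _ => Nat.cast_nonneg _)

theorem freqWeight_pos (n : ι → ℕ) : 0 < freqWeight n := one_pos.trans_le (one_le_freqWeight n)

theorem le_freqWeight (n : ι → ℕ) (j : ι) : 1 + (n j : ℝ) ≤ freqWeight n :=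
  add_le_add le_rfl (Finset.single_le_sum (f := fun j => (n j : ℝ))
    (fun _ _ => Nat.cast_nonneg _) (Finset.mem_univ j))

theorem cosNormalizer_pos (n : ι → ℕ) : 0 < cosNormalizer n :=
  Finset.prod_pos fun j _ => by split_ifs <;> norm_num

theorem cosNormalizer_le (n : ι → ℕ) : cosNormalizer n ≤ 2 ^ Fintype.card ι := by
  unfold cosNormalizer
  exact prod_univ_le_pow_card (fun j => by split_ifs <;> norm_num)
    fun j => by split_ifs <;> norm_num

theorem abs_cosBasis_le_one (n : ι → ℕ) (x : ι → ℝ) : |cosBasis n x| ≤ 1 := by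
  rw [cosBasis, Finset.abs_prod]
  exact Finset.prod_le_one (fun _ _ => abs_nonneg _) fun _ _ => Real.abs_cos_le_one _

theorem contDiff_cosBasis (n : ι → ℕ) : ContDiff ℝ ∞ (cosBasis n) := by
  unfold cosBasis
  fun_prop

theorem continuous_cosBasis (n : ι → ℕ) : Continuous (cosBasis n) := (contDiff_cosBasis n).continuous

theorem isCompact_unitCube {ι : Type*} : IsCompact (unitCube ι) :=
  isCompact_univ_pi fun _ => isCompact_Icc

theorem volume_unitCube : volume (unitCube ι) = 1 := by
  rw [unitCube, volume_pi_pi]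
  simp

theorem volume_restrict_unitCube : (volume : Measure (ι → ℝ)).restrict (unitCube ι) =
    Measure.pi fun _ => volume.restrict (Set.Icc 0 1) := by
  rw [unitCube, volume_pi, Measure.restrict_pi_pi]

/-! #### Growth of the derivatives of the cosine products -/

/-- All derivatives of the cosine are bounded by `1`, so each factor has globally bounded
derivatives; the Leibniz rule, applied one factor at a time, gives the product. -/
theorem exists_bound_iteratedFDeriv_cosBasis_one (m : ℕ) :
    ∃ C : ℝ, ∀ x, ‖iteratedFDeriv ℝ m (cosBasis (fun _ : ι => 1)) x‖ ≤ C := by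
  classical
  have key : ∀ s : Finset ι, ContDiff ℝ ∞ (fun x : ι → ℝ => ∏ j ∈ s, Real.cos (Real.pi * x j)) ∧
      ∀ m : ℕ, ∃ C : ℝ, ∀ x, ‖iteratedFDeriv ℝ m
        (fun x : ι → ℝ => ∏ j ∈ s, Real.cos (Real.pi * x j)) x‖ ≤ C := by
    intro s
    refine ⟨by fun_prop, ?_⟩
    induction s using Finset.induction_on with
    | empty =>
      intro m
      refine ⟨1, fun x => ?_⟩
      simp only [Finset.prod_empty]
      rcases m with _ | m
      · simp
      · rw [iteratedFDeriv_const_of_ne (Nat.succ_ne_zero m)]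
        simp
    | insert a s ha ih =>
      intro m
      have hcos : ∀ (m : ℕ) (x : ι → ℝ), ‖iteratedFDeriv ℝ m
          (fun x : ι → ℝ => Real.cos (Real.pi * x a)) x‖ ≤
            ‖(Real.pi • ContinuousLinearMap.proj (R := ℝ) (φ := fun _ : ι => ℝ) a)‖ ^ m := by
        intro m x
        have h := (Real.pi • ContinuousLinearMap.proj (R := ℝ) (φ := fun _ : ι => ℝ)
          a).iteratedFDeriv_comp_right (f := Real.cos) (n := ∞) Real.contDiff_cos x (i := m)
            (by exact_mod_cast le_top)
        have h' : (Real.cos ∘ (Real.pi • ContinuousLinearMap.proj (R := ℝ) (φ := fun _ : ι => ℝ) a))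
          = fun x : ι → ℝ => Real.cos (Real.pi * x a) := by
            funext x; simp
        rw [h'] at h
        rw [h]
        refine (ContinuousMultilinearMap.norm_compContinuousLinearMap_le _ _).trans ?_
        rw [Finset.prod_const, Finset.card_univ, Fintype.card_fin,
          norm_iteratedFDeriv_eq_norm_iteratedDeriv]
        exact mul_le_of_le_one_left (by positivity) (Real.abs_iteratedDeriv_cos_le_one m _)
      choose B hB using ih
      refine ⟨∑ i ∈ Finset.range (m + 1), (m.choose i : ℝ) *
        ‖(Real.pi • ContinuousLinearMap.proj (R := ℝ) (φ := fun _ : ι => ℝ) a)‖ ^ i * B (m - i),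
        fun x => ?_⟩
      simp_rw [Finset.prod_insert ha]
      refine (norm_iteratedFDeriv_mul_le (N := ∞) (by fun_prop) (by fun_prop) x
        (by exact_mod_cast le_top)).trans (Finset.sum_le_sum fun i _ =>
          mul_le_mul (mul_le_mul_of_nonneg_left (hcos i x) (Nat.cast_nonneg _))
            (hB (m - i) x) (norm_nonneg _) (by positivity))
  obtain ⟨C, hC⟩ := (key Finset.univ).2 m
  refine ⟨C, fun x => ?_⟩
  have h : cosBasis (fun _ : ι => 1) = fun x => ∏ j, Real.cos (Real.pi * x j) := by
    funext x; simp [cosBasis]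
  rw [h]
  exact hC x

/-- The product with frequency `n` is the one with all frequencies `1` precomposed with the diagonal
map `diag (n j)`, of norm at most `freqWeight n`. Each derivative thus costs one factor of the
weight. -/
theorem exists_bound_iteratedFDeriv_cosBasis (m : ℕ) :
    ∃ C : ℝ, 0 ≤ C ∧ ∀ (n : ι → ℕ) x, ‖iteratedFDeriv ℝ m (cosBasis n) x‖ ≤ C * freqWeight n ^ m := by
  obtain ⟨C, hC⟩ := exists_bound_iteratedFDeriv_cosBasis_one (ι := ι) m
  refine ⟨C, (norm_nonneg _).trans (hC 0), fun n x => ?_⟩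
  let D : (ι → ℝ) →L[ℝ] (ι → ℝ) := ContinuousLinearMap.pi fun j =>
    (n j : ℝ) • ContinuousLinearMap.proj (R := ℝ) (φ := fun _ : ι => ℝ) j
  have hD : ‖D‖ ≤ freqWeight n := by
    refine D.opNorm_le_bound (freqWeight_pos n).le fun x => ?_
    refine (pi_norm_le_iff_of_nonneg (by have := freqWeight_pos n; positivity)).2 fun j => ?_
    simp only [D, ContinuousLinearMap.coe_pi', smul_apply,
      ContinuousLinearMap.proj_apply, norm_smul, RCLike.norm_natCast]
    exact mul_le_mul (by linarith [le_freqWeight n j]) (norm_le_pi_norm x j) (norm_nonneg _)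
      (freqWeight_pos n).le
  have h' : cosBasis n = cosBasis (fun _ : ι => 1) ∘ D := by
    funext x
    simp [cosBasis, D, mul_assoc]
  rw [h', D.iteratedFDeriv_comp_right (n := ∞) (contDiff_cosBasis _) x
    (by exact_mod_cast le_top)]
  refine (ContinuousMultilinearMap.norm_compContinuousLinearMap_le _ _).trans ?_
  rw [Finset.prod_const, Finset.card_univ, Fintype.card_fin]
  exact mul_le_mul (hC _) (pow_le_pow_left₀ (norm_nonneg _) hD m) (by positivity)
    ((norm_nonneg _).trans (hC 0))

/-- The weight dominates every `1 + n j`, so its power dominates `∏ j, (1 + n j) ^ 2`, and sums over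
boxes factor into one-dimensional convergent sums. -/
theorem summable_freqWeight_inv_pow :
    Summable fun n : ι → ℕ => (freqWeight n ^ (2 * Fintype.card ι))⁻¹ := by
  classical
  have h1 : Summable fun n : ℕ => ((1 + (n : ℝ)) ^ 2)⁻¹ := by
    have := (summable_nat_add_iff 1).2 (Real.summable_nat_pow_inv.2 (one_lt_two))
    simpa [add_comm] using this
  refine summable_of_sum_le (c := (∑' n : ℕ, ((1 + (n : ℝ)) ^ 2)⁻¹) ^ Fintype.card ι)
    (fun n => by have := freqWeight_pos n; positivity) fun u => ?_
  let t : Finset ℕ := u.biUnion fun n => Finset.univ.image n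
  calc ∑ n ∈ u, (freqWeight n ^ (2 * Fintype.card ι))⁻¹
      ≤ ∑ n ∈ u, ∏ j, ((1 + (n j : ℝ)) ^ 2)⁻¹ := by
        refine Finset.sum_le_sum fun n _ => ?_
        rw [Finset.prod_inv_distrib]
        refine inv_anti₀ (Finset.prod_pos fun j _ => by positivity) ?_
        rw [pow_mul]
        exact prod_univ_le_pow_card (fun j => by positivity) fun j =>
          pow_le_pow_left₀ (by positivity) (le_freqWeight n j) 2
    _ ≤ ∑ n ∈ Fintype.piFinset fun _ : ι => t, ∏ j, ((1 + (n j : ℝ)) ^ 2)⁻¹ := by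
        refine Finset.sum_le_sum_of_subset_of_nonneg (fun n hn => ?_)
          fun n _ _ => Finset.prod_nonneg fun j _ => by positivity
        rw [Fintype.mem_piFinset]
        exact fun j => Finset.mem_biUnion.2 ⟨n, hn, Finset.mem_image_of_mem _ (Finset.mem_univ j)⟩
    _ = ∏ _j : ι, ∑ n ∈ t, ((1 + (n : ℝ)) ^ 2)⁻¹ := by rw [Finset.prod_univ_sum]
    _ ≤ _ := prod_univ_le_pow_card
        (fun j => Finset.sum_nonneg fun _ _ => by positivity) fun j =>
        h1.sum_le_tsum _ fun _ _ => by positivity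

/-! #### Orthogonality -/

theorem integral_cos_int_mul (k : ℤ) :
    ∫ x in Set.Icc (0 : ℝ) 1, Real.cos (Real.pi * k * x) = if k = 0 then 1 else 0 := by
  rw [integral_Icc_eq_integral_Ioc, ← intervalIntegral.integral_of_le zero_le_one]
  split_ifs with h
  · simp [h]
  · have hk : Real.pi * k ≠ 0 := mul_ne_zero Real.pi_ne_zero (by exact_mod_cast h)
    rw [intervalIntegral.integral_comp_mul_left _ hk]
    simp [mul_comm Real.pi]

theorem integral_cos_mul_cos (n m : ℕ) :
    ∫ x in Set.Icc (0 : ℝ) 1, Real.cos (Real.pi * n * x) * Real.cos (Real.pi * m * x) =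
      if n = m then (if n = 0 then 1 else 2 : ℝ)⁻¹ else 0 := by
  have h : ∀ x : ℝ, Real.cos (Real.pi * n * x) * Real.cos (Real.pi * m * x) =
      (Real.cos (Real.pi * ((n - m : ℤ) : ℝ) * x) + Real.cos (Real.pi * ((n + m : ℤ) : ℝ) * x)) / 2 := by
    intro x
    push_cast
    rw [show Real.pi * ((n : ℝ) - m) * x = Real.pi * n * x - Real.pi * m * x by ring,
      show Real.pi * ((n : ℝ) + m) * x = Real.pi * n * x + Real.pi * m * x by ring,
      Real.cos_sub, Real.cos_add]
    ring
  simp_rw [h]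
  rw [integral_div, integral_add, integral_cos_int_mul, integral_cos_int_mul]
  · by_cases h1 : n = m
    · subst h1
      by_cases h2 : n = 0
      · simp [h2]
      · have : ¬ ((n : ℤ) + n = 0) := by omega
        simp [h2, this]
    · have h2 : ¬ ((n : ℤ) - m = 0) := by omega
      have h3 : ¬ ((n : ℤ) + m = 0) := by omega
      simp [h1, h2, h3]
  · exact (Continuous.integrableOn_Icc (by fun_prop))
  · exact (Continuous.integrableOn_Icc (by fun_prop))

theorem integral_cosBasis_mul_cosBasis [DecidableEq ι] (n m : ι → ℕ) :
    ∫ x in unitCube ι, cosBasis n x * cosBasis m x = if n = m then (cosNormalizer n)⁻¹ else 0 := by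
  rw [volume_restrict_unitCube]
  simp_rw [cosBasis, ← Finset.prod_mul_distrib]
  rw [integral_fintype_prod_eq_prod (𝕜 := ℝ)
    (fun j (t : ℝ) => Real.cos (Real.pi * n j * t) * Real.cos (Real.pi * m j * t))]
  simp_rw [integral_cos_mul_cos]
  split_ifs with h
  · subst h
    simp [cosNormalizer, Finset.prod_inv_distrib]
  · obtain ⟨j, hj⟩ := Function.ne_iff.1 h
    exact Finset.prod_eq_zero (Finset.mem_univ j) (if_neg hj)

end Cosine

section Cosine

open MeasureTheory Filter

variable {ι : Type*} [Fintype ι]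

/-! #### Completeness -/

/-- Product-to-sum in every coordinate; expanding the product over `j` gives a sum over the set `s`
of coordinates in which the frequencies are added. In the others the frequency is `|n j - m j|`,
written with truncated subtraction as `(n j - m j) + (m j - n j)`. -/
theorem cosBasis_mul_cosBasis_mem_span (n m : ι → ℕ) :
    (⟨cosBasis n, continuous_cosBasis n⟩ * ⟨cosBasis m, continuous_cosBasis m⟩ : C(ι → ℝ, ℝ)) ∈
      Submodule.span ℝ (Set.range fun n : ι → ℕ =>
        (⟨cosBasis n, continuous_cosBasis n⟩ : C(ι → ℝ, ℝ))) := by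
  classical
  have h : (⟨cosBasis n, continuous_cosBasis n⟩ * ⟨cosBasis m, continuous_cosBasis m⟩ :
      C(ι → ℝ, ℝ)) = (2⁻¹ : ℝ) ^ Fintype.card ι • ∑ s ∈ (Finset.univ : Finset ι).powerset,
        (⟨cosBasis (s.piecewise (n + m) fun j => (n j - m j) + (m j - n j)),
          continuous_cosBasis _⟩ : C(ι → ℝ, ℝ)) := by
    ext x
    have h1 : ∀ a b : ℕ, ∀ t : ℝ, Real.cos (Real.pi * a * t) * Real.cos (Real.pi * b * t) =
        2⁻¹ * (Real.cos (Real.pi * ((a + b : ℕ) : ℝ) * t) +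
          Real.cos (Real.pi * ((a - b + (b - a) : ℕ) : ℝ) * t)) := by
      intro a b t
      have h2 : Real.cos (Real.pi * ((a - b + (b - a) : ℕ) : ℝ) * t) =
          Real.cos (Real.pi * a * t - Real.pi * b * t) := by
        rcases le_total a b with hab | hab
        · rw [Nat.sub_eq_zero_of_le hab, zero_add, Nat.cast_sub hab, ← Real.cos_neg]
          congr 1; ring
        · rw [Nat.sub_eq_zero_of_le hab, add_zero, Nat.cast_sub hab]
          congr 1; ring
      rw [h2, Nat.cast_add, show Real.pi * ((a : ℝ) + b) * t = Real.pi * a * t + Real.pi * b * t by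
        ring, Real.cos_add, Real.cos_sub]
      ring
    simp only [ContinuousMap.mul_apply, ContinuousMap.coe_mk, ContinuousMap.smul_apply,
      ContinuousMap.sum_apply, cosBasis, smul_eq_mul]
    rw [← Finset.prod_mul_distrib]
    simp_rw [h1]
    rw [Finset.prod_mul_distrib, Finset.prod_const, Finset.card_univ, Finset.prod_add]
    congr 1
    refine Finset.sum_congr rfl fun s _ => ?_
    rw [← Finset.prod_sdiff (Finset.subset_univ s), mul_comm]
    congr 1
    · refine Finset.prod_congr rfl fun j hj => ?_
      rw [Finset.piecewise_eq_of_notMem _ _ _ (Finset.mem_sdiff.1 hj).2]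
    · refine Finset.prod_congr rfl fun j hj => ?_
      rw [Finset.piecewise_eq_of_mem _ _ _ hj]
      rfl
  rw [h]
  exact Submodule.smul_mem _ _ (Submodule.sum_mem _ fun s _ => Submodule.subset_span ⟨_, rfl⟩)

variable (ι) in
/-- The algebra of trigonometric polynomials in the cosine products. -/
def cosAlgebra : Subalgebra ℝ C(ι → ℝ, ℝ) :=
  (Submodule.span ℝ (Set.range fun n : ι → ℕ =>
    (⟨cosBasis n, continuous_cosBasis n⟩ : C(ι → ℝ, ℝ)))).toSubalgebra
  (Submodule.subset_span ⟨0, by ext x; simp [cosBasis]⟩)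
  (fun f g hf hg => by
    induction hf using Submodule.span_induction with
    | zero => simp
    | add a b _ _ ha hb => rw [add_mul]; exact add_mem ha hb
    | smul c a _ ha => rw [smul_mul_assoc]; exact Submodule.smul_mem _ _ ha
    | mem a ha =>
      obtain ⟨n, rfl⟩ := ha
      induction hg using Submodule.span_induction with
      | zero => simp
      | add a b _ _ ha hb => rw [mul_add]; exact add_mem ha hb
      | smul c a _ ha => rw [mul_smul_comm]; exact Submodule.smul_mem _ _ ha
      | mem b hb =>
        obtain ⟨m, rfl⟩ := hb
        exact cosBasis_mul_cosBasis_mem_span n m)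

/-- Stone–Weierstrass on the cube: points are separated because `t ↦ cos (π t)` is injective on `[0,
1]`. -/
theorem exists_mem_cosAlgebra_near {h : (ι → ℝ) → ℝ} (hc : Continuous h) {ε : ℝ} (hε : 0 < ε) :
    ∃ p ∈ cosAlgebra ι, ∀ x ∈ unitCube ι, |p x - h x| < ε := by
  classical
  have : CompactSpace (unitCube ι) := isCompact_iff_compactSpace.1 isCompact_unitCube
  let R : C(ι → ℝ, ℝ) →ₐ[ℝ] C(unitCube ι, ℝ) :=
    ContinuousMap.compRightAlgHom ℝ ℝ ⟨Subtype.val, continuous_subtype_val⟩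
  have hsep : ((cosAlgebra ι).map R).SeparatesPoints := by
    intro x y hxy
    have : ∃ j, x.1 j ≠ y.1 j := by
      by_contra! hcon
      exact hxy (Subtype.ext (funext hcon))
    obtain ⟨j, hj⟩ := this
    let p : C(ι → ℝ, ℝ) := ⟨cosBasis (Pi.single j 1), continuous_cosBasis _⟩
    refine ⟨_, ⟨R p, ⟨p, Submodule.subset_span ⟨_, rfl⟩, rfl⟩, rfl⟩, ?_⟩
    have hp : ∀ z : unitCube ι, R p z = Real.cos (Real.pi * z.1 j) := by
      intro z
      change cosBasis _ _ = _
      rw [cosBasis, Finset.prod_eq_single j]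
      · simp
      · intro i _ hi
        simp [Pi.single_eq_of_ne hi]
      · simp
    intro heq
    change R p x = R p y at heq
    rw [hp, hp] at heq
    have hmem : ∀ z : unitCube ι, Real.pi * z.1 j ∈ Set.Icc 0 Real.pi := fun z => by
      have hz := z.2 j trivial
      have := Real.pi_pos
      exact ⟨mul_nonneg this.le hz.1, mul_le_of_le_one_right this.le hz.2⟩
    have := Real.injOn_cos (hmem x) (hmem y) heq
    exact hj (mul_left_cancel₀ Real.pi_ne_zero this)
  obtain ⟨⟨g, hg⟩, hgε⟩ := ContinuousMap.exists_mem_subalgebra_near_continuous_of_separatesPoints _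
    hsep (fun x : unitCube ι => h x) (hc.comp continuous_subtype_val) ε hε
  obtain ⟨p, hp, rfl⟩ := hg
  exact ⟨p, hp, fun x hx => hgε ⟨x, hx⟩⟩

theorem unitCube_subset_closure_interior : unitCube ι ⊆ closure (interior (unitCube ι)) := by
  rw [unitCube, interior_pi_set Set.finite_univ, closure_pi_set]
  simp [interior_Icc, closure_Ioo]

/-- `h` is orthogonal to the whole cosine algebra, so `∫ h² = ∫ h (h - p)` for every `p` in it, and
this is small when `p` is uniformly close to `h`. Vanishing almost everywhere becomes vanishing
everywhere by continuity, as the cube lies in the closure of its interior. -/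
theorem eq_zero_of_integral_mul_cosBasis_eq_zero {h : (ι → ℝ) → ℝ} (hc : Continuous h)
    (h0 : ∀ n, ∫ x in unitCube ι, h x * cosBasis n x = 0) : ∀ x ∈ unitCube ι, h x = 0 := by
  have hint : ∀ g : (ι → ℝ) → ℝ, Continuous g → IntegrableOn g (unitCube ι) := fun g hg =>
    hg.continuousOn.integrableOn_compact isCompact_unitCube
  have hp : ∀ p ∈ cosAlgebra ι, ∫ x in unitCube ι, h x * p x = 0 := by
    intro p hp
    change p ∈ Submodule.span ℝ _ at hp
    induction hp using Submodule.span_induction with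
    | zero => simp
    | add a b _ _ ha hb =>
      simp only [ContinuousMap.add_apply, mul_add]
      rw [integral_add (hint _ (by fun_prop)) (hint _ (by fun_prop)), ha, hb, add_zero]
    | smul c a _ ha =>
      simp only [ContinuousMap.smul_apply, smul_eq_mul, mul_left_comm _ c]
      rw [integral_const_mul, ha, mul_zero]
    | mem a ha =>
      obtain ⟨n, rfl⟩ := ha
      exact h0 n
  obtain ⟨C, hC⟩ := isCompact_unitCube.exists_bound_of_continuousOn hc.continuousOn
  have hsq : ∫ x in unitCube ι, h x * h x = 0 := by
    refine le_antisymm (le_of_forall_pos_le_add fun ε hε => ?_)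
      (integral_nonneg fun x => mul_self_nonneg _)
    -- `C` bounds `‖h‖` on the cube; this accuracy makes `‖h * (h - p)‖` at most `ε` there.
    obtain ⟨p, hpm, hpn⟩ := exists_mem_cosAlgebra_near hc (show 0 < ε / (|C| + 1) by positivity)
    have e1 : ∫ x in unitCube ι, h x * h x = ∫ x in unitCube ι, h x * (h x - p x) := by
      simp only [mul_sub]
      rw [integral_sub (hint _ (by fun_prop)) (hint _ (by fun_prop)), hp p hpm, sub_zero]
    rw [e1, zero_add]
    have := norm_setIntegral_le_of_norm_le_const (μ := volume) (s := unitCube ι)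
      (f := fun x => h x * (h x - p x)) (C := ε) (by rw [volume_unitCube]; simp) (fun x hx => by
        rw [norm_mul, norm_sub_rev]
        calc ‖h x‖ * ‖p x - h x‖ ≤ (|C| + 1) * (ε / (|C| + 1)) := by
              refine mul_le_mul ?_ (hpn x hx).le (norm_nonneg _) (by positivity)
              linarith [hC x hx, le_abs_self C]
          _ = ε := by field_simp)
    refine (le_abs_self _).trans (this.trans ?_)
    simp [Measure.real, volume_unitCube]
  have hae := (setIntegral_eq_zero_iff_of_nonneg_ae
    (Eventually.of_forall fun x => mul_self_nonneg (h x)) (hint _ (by fun_prop))).1 hsq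
  have := Measure.eqOn_of_ae_eq (μ := (volume : Measure (ι → ℝ))) hae (by fun_prop)
    continuousOn_const unitCube_subset_closure_interior
  exact fun x hx => mul_self_eq_zero.1 (this hx)

/-! #### Decay of the coefficients -/

variable {𝕜 : Type*} [RCLike 𝕜]

/-- The coefficients of the cosine series of `f`. -/
def cosCoeff (f : (ι → ℝ) → 𝕜) (n : ι → ℕ) : 𝕜 := cosNormalizer n • ∫ x, cosBasis n x • f x

/-- Along the `j`-th axis only the `j`-th factor moves. That factor is left arbitrary because
integrating by parts twice replaces the cosine by a sine in between. -/
theorem hasLineDerivAt_mul_apply [DecidableEq ι] (n : ι → ℕ) (j : ι) {g g' : ℝ → ℝ}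
    (hg : ∀ t, HasDerivAt g (g' t) t) (x : ι → ℝ) :
    HasLineDerivAt ℝ (fun x : ι → ℝ =>
        (∏ i ∈ Finset.univ.erase j, Real.cos (Real.pi * n i * x i)) * g (x j))
      ((∏ i ∈ Finset.univ.erase j, Real.cos (Real.pi * n i * x i)) * g' (x j)) x
      (Pi.single j (1 : ℝ)) := by
  unfold HasLineDerivAt
  have h1 : ∀ t : ℝ, (∏ i ∈ Finset.univ.erase j,
      Real.cos (Real.pi * n i * (x + t • (Pi.single j (1 : ℝ) : ι → ℝ)) i)) =
      ∏ i ∈ Finset.univ.erase j, Real.cos (Real.pi * n i * x i) := fun t =>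
    Finset.prod_congr rfl fun i hi => by simp [Pi.single_eq_of_ne (Finset.ne_of_mem_erase hi)]
  simp only [h1]
  simp only [Pi.add_apply, Pi.smul_apply, Pi.single_eq_same, smul_eq_mul, mul_one]
  refine HasDerivAt.const_mul _ ?_
  have := (hg (x j + 0)).comp_const_add (x j) 0
  simpa using this

theorem hasLineDerivAt_iteratedFDeriv_apply {E F : Type*} [NormedAddCommGroup E] [NormedSpace ℝ E]
    [NormedAddCommGroup F] [NormedSpace ℝ F] {f : E → F} (hf : ContDiff ℝ ∞ f) (m : ℕ) (v x : E) :
    HasLineDerivAt ℝ (fun x => iteratedFDeriv ℝ m f x fun _ => v)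
      (iteratedFDeriv ℝ (m + 1) f x fun _ => v) x v := by
  have h1 : HasFDerivAt (iteratedFDeriv ℝ m f) (fderiv ℝ (iteratedFDeriv ℝ m f) x) x :=
    (hf.differentiable_iteratedFDeriv (by exact_mod_cast WithTop.coe_lt_top _)
      x).hasFDerivAt
  have h2 := ((ContinuousMultilinearMap.apply ℝ (fun _ : Fin m => E) F
    (fun _ => v)).hasFDerivAt.comp x h1).hasLineDerivAt v
  exact h2

/-- Two integrations by parts along the `j`-th axis; compact support removes the boundary terms, and
the second derivative of the cosine is a multiple of itself. -/
theorem integral_cosBasis_smul_iteratedFDeriv [DecidableEq ι] {f : (ι → ℝ) → 𝕜}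
    (hf : ContDiff ℝ ∞ f) (hs : HasCompactSupport f) (n : ι → ℕ) (j : ι) (m : ℕ) :
    ∫ x, cosBasis n x • iteratedFDeriv ℝ (m + 2) f x (fun _ => Pi.single j (1 : ℝ)) =
      -((Real.pi * n j) ^ 2 •
        ∫ x, cosBasis n x • iteratedFDeriv ℝ m f x (fun _ => Pi.single j (1 : ℝ))) := by
  set v : ι → ℝ := Pi.single j (1 : ℝ) with hv
  set P : (ι → ℝ) → ℝ := fun x => ∏ i ∈ Finset.univ.erase j, Real.cos (Real.pi * n i * x i) with hP
  set a : ℝ := Real.pi * n j with ha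
  set G : ℕ → (ι → ℝ) → 𝕜 := fun m x => iteratedFDeriv ℝ m f x (fun _ => v) with hG
  have hβ : ∀ x, cosBasis n x = P x * Real.cos (a * x j) := fun x =>
    (Finset.prod_erase_mul _ _ (Finset.mem_univ j)).symm
  have hPc : Continuous P := by fun_prop
  have hGc : ∀ m, Continuous (G m) := fun m =>
    (ContinuousMultilinearMap.apply ℝ (fun _ : Fin m => ι → ℝ) 𝕜 (fun _ => v)).continuous.comp
      (hf.continuous_iteratedFDeriv (by exact_mod_cast le_top))
  have hGs : ∀ m, HasCompactSupport (G m) := fun m =>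
    (hs.iteratedFDeriv (𝕜 := ℝ) m).comp_left
      (g := fun T : ContinuousMultilinearMap ℝ (fun _ : Fin m => ι → ℝ) 𝕜 => T fun _ => v) rfl
  have hint : ∀ (g : (ι → ℝ) → ℝ) m, Continuous g → Integrable (fun x => g x • G m x) :=
    fun g m hg => (hg.smul (hGc m)).integrable_of_hasCompactSupport (hGs m).smul_left
  have key : ∀ (g g' : ℝ → ℝ) (m : ℕ), (∀ t, HasDerivAt g (g' t) t) → Continuous g' →
      ∫ x, (P x * g (x j)) • G (m + 1) x = - ∫ x, (P x * g' (x j)) • G m x := by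
    intro g g' m hg hg'
    have hgc : Continuous g := continuous_iff_continuousAt.2 fun t => (hg t).continuousAt
    exact integral_bilinear_hasLineDerivAt_right_eq_neg_left_of_integrable (v := v)
      (B := ContinuousLinearMap.lsmul ℝ ℝ)
      (hint _ _ (by fun_prop)) (hint _ _ (by fun_prop)) (hint _ _ (by fun_prop))
      (fun x _ => hasLineDerivAt_mul_apply n j hg x)
      (fun x _ => hasLineDerivAt_iteratedFDeriv_apply hf m v x)
  have hc : ∀ t, HasDerivAt (fun t => Real.cos (a * t)) (-(a * Real.sin (a * t))) t := fun t => by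
    have := (Real.hasDerivAt_cos (a * t)).comp t ((hasDerivAt_id t).const_mul a)
    exact this.congr_deriv (by ring)
  have hsn : ∀ t, HasDerivAt (fun t => -(a * Real.sin (a * t))) (-(a ^ 2 * Real.cos (a * t))) t :=
    fun t => by
      have := (((Real.hasDerivAt_sin (a * t)).comp t ((hasDerivAt_id t).const_mul a)).const_mul
        a).neg
      exact this.congr_deriv (by ring)
  simp_rw [hβ]
  change ∫ x, (P x * Real.cos (a * x j)) • G (m + 1 + 1) x = _
  rw [key _ _ (m + 1) hc (by fun_prop), key _ _ m hsn (by fun_prop), neg_neg,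
    ← integral_smul, ← integral_neg]
  refine integral_congr_ae (Eventually.of_forall fun x => ?_)
  change _ = -(a ^ 2 • (P x * Real.cos (a * x j)) • G m x)
  rw [smul_smul, ← neg_smul]
  exact congrArg (· • G m x) (by ring)

theorem norm_integral_cosBasis_smul_le {g : (ι → ℝ) → 𝕜} {B : ℝ} (hs : ∀ x ∉ unitCube ι, g x = 0)
    (hB : ∀ x ∈ unitCube ι, ‖g x‖ ≤ B) (n : ι → ℕ) : ‖∫ x, cosBasis n x • g x‖ ≤ B := by
  rw [← setIntegral_eq_integral_of_forall_compl_eq_zero (s := unitCube ι)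
    fun x hx => by rw [hs x hx, smul_zero]]
  refine (norm_setIntegral_le_of_norm_le_const (C := B) (by rw [volume_unitCube]; simp)
    fun x hx => ?_).trans ?_
  · rw [norm_smul]
    exact (mul_le_of_le_one_left (norm_nonneg _) (abs_cosBasis_le_one n x)).trans (hB x hx)
  · simp [Measure.real, volume_unitCube]

/-- Integrating by parts `2 * N` times along axis `j` gains the factor `(π n j) ^ (2 * N)`. Taking
for `j` the axis of largest frequency turns this into decay in the full weight, which exceeds that
frequency at most by the factor `card ι + 1`. -/
theorem norm_cosCoeff_le {f : (ι → ℝ) → 𝕜} (hf : ContDiff ℝ ∞ f) (hs : tsupport f ⊆ unitCube ι)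
    {N : ℕ} {B : ℝ} (hB : ∀ m ≤ 2 * N, ∀ x ∈ unitCube ι, ‖iteratedFDeriv ℝ m f x‖ ≤ B)
    (n : ι → ℕ) :
    ‖cosCoeff f n‖ ≤ 2 ^ Fintype.card ι * (Fintype.card ι + 1) ^ (2 * N) * B /
      freqWeight n ^ (2 * N) := by
  classical
  have hcs : HasCompactSupport f := isCompact_unitCube.of_isClosed_subset (isClosed_tsupport f) hs
  have hB0 : 0 ≤ B := (norm_nonneg _).trans (hB 0 (Nat.zero_le _) 0 fun j _ => ⟨le_rfl, zero_le_one⟩)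
  have h0 : ‖∫ x, cosBasis n x • f x‖ ≤ B := by
    refine norm_integral_cosBasis_smul_le (fun x hx => image_eq_zero_of_notMem_tsupport
      fun h => hx (hs h)) (fun x hx => ?_) n
    simpa using hB 0 (Nat.zero_le _) x hx
  have hj : ∀ j, (n j : ℝ) ^ (2 * N) * ‖∫ x, cosBasis n x • f x‖ ≤ B := by
    intro j
    have h1 : ∀ N : ℕ, ‖∫ x, cosBasis n x • iteratedFDeriv ℝ (2 * N) f x
        (fun _ => Pi.single j (1 : ℝ))‖ = (Real.pi * n j) ^ (2 * N) *
          ‖∫ x, cosBasis n x • f x‖ := by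
      intro N
      induction N with
      | zero => simp
      | succ N ih =>
        rw [Nat.mul_succ, integral_cosBasis_smul_iteratedFDeriv hf hcs n j (2 * N), norm_neg,
          norm_smul, ih, Real.norm_of_nonneg (by positivity)]
        ring
    calc (n j : ℝ) ^ (2 * N) * ‖∫ x, cosBasis n x • f x‖
        ≤ (Real.pi * n j) ^ (2 * N) * ‖∫ x, cosBasis n x • f x‖ := by
          refine mul_le_mul_of_nonneg_right (pow_le_pow_left₀ (Nat.cast_nonneg _) ?_ _)
            (norm_nonneg _)
          exact le_mul_of_one_le_left (Nat.cast_nonneg _) (by linarith [Real.pi_gt_three])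
      _ ≤ B := by
          rw [← h1]
          refine norm_integral_cosBasis_smul_le (fun x hx => ?_) (fun x hx => ?_) n
          · rw [image_eq_zero_of_notMem_tsupport (f := iteratedFDeriv ℝ (2 * N) f)
              fun h => hx (hs (tsupport_iteratedFDeriv_subset _ h))]
            rfl
          · refine (ContinuousMultilinearMap.le_opNorm _ _).trans ?_
            have : ‖(Pi.single j (1 : ℝ) : ι → ℝ)‖ ≤ 1 :=
              (pi_norm_le_iff_of_nonneg zero_le_one).2 fun i => by
                rcases eq_or_ne i j with rfl | hij
                · rw [Pi.single_eq_same, norm_one]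
                · rw [Pi.single_eq_of_ne hij, norm_zero]
                  exact zero_le_one
            exact (mul_le_of_le_one_right (norm_nonneg _)
              (Finset.prod_le_one (fun _ _ => norm_nonneg _) fun _ _ => this)).trans (hB _ le_rfl x hx)
  have hW : freqWeight n ^ (2 * N) * ‖∫ x, cosBasis n x • f x‖ ≤
      (Fintype.card ι + 1) ^ (2 * N) * B := by
    -- `b` is the largest frequency, or `1` when all frequencies vanish and no integration by parts
    -- is available.
    obtain ⟨b, hb1, hb2, hb3⟩ : ∃ b : ℝ, 1 ≤ b ∧ (∀ j, (n j : ℝ) ≤ b) ∧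
        b ^ (2 * N) * ‖∫ x, cosBasis n x • f x‖ ≤ B := by
      by_cases hn : ∀ j, n j = 0
      · exact ⟨1, le_rfl, fun j => by rw [hn j, Nat.cast_zero]; exact zero_le_one,
          by rw [one_pow, one_mul]; exact h0⟩
      · push Not at hn
        obtain ⟨i, hi⟩ := hn
        obtain ⟨j, -, hjmax⟩ := Finset.exists_max_image Finset.univ n ⟨i, Finset.mem_univ i⟩
        refine ⟨n j, ?_, fun i => by exact_mod_cast hjmax i (Finset.mem_univ i), hj j⟩
        exact_mod_cast (Nat.one_le_iff_ne_zero.2 hi).trans (hjmax i (Finset.mem_univ i))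
    have hWb : freqWeight n ≤ (Fintype.card ι + 1) * b := by
      have : ∑ j, (n j : ℝ) ≤ Fintype.card ι * b := by
        calc ∑ j, (n j : ℝ) ≤ ∑ _j : ι, b := Finset.sum_le_sum fun j _ => hb2 j
          _ = _ := by rw [Finset.sum_const, Finset.card_univ, nsmul_eq_mul]
      unfold freqWeight
      linarith
    calc freqWeight n ^ (2 * N) * ‖∫ x, cosBasis n x • f x‖
        ≤ ((Fintype.card ι + 1) * b) ^ (2 * N) * ‖∫ x, cosBasis n x • f x‖ :=
          mul_le_mul_of_nonneg_right (pow_le_pow_left₀ (freqWeight_pos n).le hWb _) (norm_nonneg _)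
      _ = (Fintype.card ι + 1) ^ (2 * N) * (b ^ (2 * N) * ‖∫ x, cosBasis n x • f x‖) := by
          rw [mul_pow, mul_assoc]
      _ ≤ _ := mul_le_mul_of_nonneg_left hb3 (by positivity)
  rw [le_div_iff₀ (pow_pos (freqWeight_pos n) _), cosCoeff, norm_smul,
    Real.norm_of_nonneg (cosNormalizer_pos n).le]
  calc cosNormalizer n * ‖∫ x, cosBasis n x • f x‖ * freqWeight n ^ (2 * N)
      = cosNormalizer n * (freqWeight n ^ (2 * N) * ‖∫ x, cosBasis n x • f x‖) := by ring
    _ ≤ 2 ^ Fintype.card ι * ((Fintype.card ι + 1) ^ (2 * N) * B) :=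
        mul_le_mul (cosNormalizer_le n) hW
          (mul_nonneg (pow_nonneg (freqWeight_pos n).le _) (norm_nonneg _)) (by positivity)
    _ = _ := by ring

end Cosine

/-! ### Convergence of the cosine series with all derivatives -/

section Cosine

open MeasureTheory Filter

variable {ι : Type*} [Fintype ι] {𝕜 : Type*} [RCLike 𝕜]

theorem summable_norm_cosCoeff_mul {f : (ι → ℝ) → 𝕜} (hf : ContDiff ℝ ∞ f)
    (hs : tsupport f ⊆ unitCube ι) (q : ℕ) :
    Summable fun n => ‖cosCoeff f n‖ * freqWeight n ^ q := by
  have hB : ∀ m, ∃ B, ∀ x ∈ unitCube ι, ‖iteratedFDeriv ℝ m f x‖ ≤ B := fun m =>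
    isCompact_unitCube.exists_bound_of_continuousOn
      (hf.continuous_iteratedFDeriv (m := m) (by exact_mod_cast le_top)).continuousOn
  choose B hB using hB
  -- The decay `2 * N` pays for the growth `q` and still leaves the summable exponent `2 * card ι`.
  set N := q + Fintype.card ι
  set B' := ∑ m ∈ Finset.range (2 * N + 1), |B m|
  have hB' : ∀ m ≤ 2 * N, ∀ x ∈ unitCube ι, ‖iteratedFDeriv ℝ m f x‖ ≤ B' := fun m hm x hx =>
    ((hB m x hx).trans (le_abs_self _)).trans (Finset.single_le_sum (f := fun m => |B m|)
      (fun _ _ => abs_nonneg _) (Finset.mem_range.2 (Nat.lt_succ_of_le hm)))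
  have hB0 : 0 ≤ B' := Finset.sum_nonneg fun _ _ => abs_nonneg _
  refine Summable.of_nonneg_of_le (fun n => mul_nonneg (norm_nonneg _)
    (pow_nonneg (freqWeight_pos n).le _)) (fun n => ?_) (summable_freqWeight_inv_pow.mul_left
      (2 ^ Fintype.card ι * (Fintype.card ι + 1) ^ (2 * N) * B'))
  have h := norm_cosCoeff_le hf hs hB' n
  refine (mul_le_mul_of_nonneg_right h (pow_nonneg (freqWeight_pos n).le _)).trans ?_
  have hW := freqWeight_pos n
  rw [div_mul_eq_mul_div, mul_div_assoc]
  refine mul_le_mul_of_nonneg_left ?_ (by positivity)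
  rw [div_le_iff₀ (by positivity), inv_mul_eq_div, le_div_iff₀ (by positivity), ← pow_add]
  exact pow_le_pow_right₀ (one_le_freqWeight n) (by omega)

theorem exists_bound_iteratedFDeriv_cosBasis_smul (m : ℕ) :
    ∃ C : ℝ, 0 ≤ C ∧ ∀ (n : ι → ℕ) (a : 𝕜) x, ‖iteratedFDeriv ℝ m (fun x => cosBasis n x • a) x‖ ≤
      C * (‖a‖ * freqWeight n ^ m) := by
  obtain ⟨C, hC0, hC⟩ := exists_bound_iteratedFDeriv_cosBasis (ι := ι) m
  refine ⟨C, hC0, fun n a x => ?_⟩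
  have h := (ContinuousLinearMap.toSpanSingleton ℝ a).norm_iteratedFDeriv_comp_left
    (f := cosBasis n) (x := x) ((contDiff_cosBasis n).contDiffAt) (n := m)
    (by exact_mod_cast le_top)
  refine h.trans ?_
  rw [ContinuousLinearMap.norm_toSpanSingleton]
  calc ‖a‖ * ‖iteratedFDeriv ℝ m (cosBasis n) x‖ ≤ ‖a‖ * (C * freqWeight n ^ m) :=
        mul_le_mul_of_nonneg_left (hC n x) (norm_nonneg _)
    _ = _ := by ring

/-- The cosine series of a smooth function supported in the cube converges to it there. -/
theorem hasSum_cosCoeff {f : (ι → ℝ) → 𝕜} (hf : ContDiff ℝ ∞ f) (hs : tsupport f ⊆ unitCube ι)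
    {x : ι → ℝ} (hx : x ∈ unitCube ι) : HasSum (fun n => cosBasis n x • cosCoeff f n) (f x) := by
  classical
  have hsum : Summable fun n => ‖cosCoeff f n‖ := by
    simpa using summable_norm_cosCoeff_mul hf hs 0
  have hle : ∀ n x, ‖cosBasis n x • cosCoeff f n‖ ≤ ‖cosCoeff f n‖ := fun n x => by
    rw [norm_smul]
    exact mul_le_of_le_one_left (norm_nonneg _) (abs_cosBasis_le_one n x)
  set g : (ι → ℝ) → 𝕜 := fun x => ∑' n, cosBasis n x • cosCoeff f n with hg
  have hgc : Continuous g := continuous_tsum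
    (fun n => (continuous_cosBasis n).smul continuous_const) hsum hle
  have hint : ∀ h : (ι → ℝ) → 𝕜, Continuous h → IntegrableOn h (unitCube ι) := fun h hh =>
    hh.continuousOn.integrableOn_compact isCompact_unitCube
  -- The series may be integrated term by term, so by orthogonality `f` and its series `g` have the
  -- same coefficients.
  have hcoef : ∀ m, ∫ x in unitCube ι, cosBasis m x • (f x - g x) = 0 := by
    intro m
    have e1 : ∫ x in unitCube ι, cosBasis m x • f x = (cosNormalizer m)⁻¹ • cosCoeff f m := by
      rw [setIntegral_eq_integral_of_forall_compl_eq_zero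
        fun x hx => by rw [image_eq_zero_of_notMem_tsupport fun h => hx (hs h), smul_zero],
        cosCoeff, inv_smul_smul₀ (cosNormalizer_pos m).ne']
    have e2 : HasSum (fun n => ∫ x in unitCube ι, cosBasis m x • cosBasis n x • cosCoeff f n)
        (∫ x in unitCube ι, ∑' n, cosBasis m x • cosBasis n x • cosCoeff f n) := by
      refine hasSum_integral_of_summable_integral_norm (fun n => hint _
        ((continuous_cosBasis m).smul ((continuous_cosBasis n).smul continuous_const)))
        (Summable.of_nonneg_of_le (fun n => integral_nonneg fun x => norm_nonneg _) (fun n => ?_) hsum)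
      have := norm_setIntegral_le_of_norm_le_const (μ := volume) (s := unitCube ι)
        (f := fun x => ‖cosBasis m x • cosBasis n x • cosCoeff f n‖) (C := ‖cosCoeff f n‖)
        (by rw [volume_unitCube]; simp) (fun x _ => by
          rw [norm_norm, norm_smul]
          exact (mul_le_of_le_one_left (norm_nonneg _) (abs_cosBasis_le_one m x)).trans (hle n x))
      refine (le_abs_self _).trans (this.trans ?_)
      simp [Measure.real, volume_unitCube]
    have e3 : ∀ n, ∫ x in unitCube ι, cosBasis m x • cosBasis n x • cosCoeff f n =
        if n = m then (cosNormalizer m)⁻¹ • cosCoeff f m else 0 := by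
      intro n
      simp_rw [smul_smul]
      rw [integral_smul_const, integral_cosBasis_mul_cosBasis]
      by_cases h : n = m
      · subst h; simp
      · rw [if_neg h, if_neg (Ne.symm h), zero_smul]
    have e4 : ∫ x in unitCube ι, cosBasis m x • g x = (cosNormalizer m)⁻¹ • cosCoeff f m := by
      simp_rw [e3] at e2
      rw [← (e2.unique (hasSum_ite_eq m _))]
      refine integral_congr_ae (Eventually.of_forall fun x => ?_)
      exact ((Summable.of_norm_bounded hsum (hle · x)).tsum_const_smul _).symm
    simp_rw [smul_sub]
    have e5 := integral_sub (hint (fun x => cosBasis m x • f x)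
      ((continuous_cosBasis m).smul hf.continuous)) (hint (fun x => cosBasis m x • g x)
      ((continuous_cosBasis m).smul hgc))
    rw [e5, e1, e4, sub_self]
  -- Completeness was shown for real functions; it is applied to the real and the imaginary part
  -- through real-linear forms.
  have hlin : ∀ L : 𝕜 →L[ℝ] ℝ, L (f x - g x) = 0 := fun L => by
    refine eq_zero_of_integral_mul_cosBasis_eq_zero (h := fun x => L (f x - g x))
      (L.continuous.comp (hf.continuous.sub hgc)) (fun n => ?_) x hx
    have := L.integral_comp_comm (hint (fun x => cosBasis n x • (f x - g x))
      ((continuous_cosBasis n).smul (hf.continuous.sub hgc)))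
    rw [hcoef n, map_zero] at this
    rw [← this]
    refine integral_congr_ae (Eventually.of_forall fun x => ?_)
    simp [mul_comm]
  have : f x = g x := sub_eq_zero.1 (RCLike.ext (by simpa using hlin RCLike.reCLM)
    (by simpa using hlin RCLike.imCLM))
  rw [this]
  exact (Summable.of_norm_bounded hsum (hle · x)).hasSum

/-- The remainders of the cosine series of `f` extend to smooth functions which converge to `0`
with all their derivatives, uniformly on the whole space. -/
theorem exists_cosSeries_remainder {f : (ι → ℝ) → 𝕜} (hf : ContDiff ℝ ∞ f)
    (hs : tsupport f ⊆ unitCube ι) :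
    ∃ R : Finset (ι → ℕ) → (ι → ℝ) → 𝕜, (∀ S, ContDiff ℝ ∞ (R S)) ∧
      (∀ S, ∀ x ∈ unitCube ι, R S x = f x - ∑ n ∈ S, cosBasis n x • cosCoeff f n) ∧
      ∀ (m : ℕ) (ε : ℝ), 0 < ε → ∀ᶠ S in atTop, ∀ x, ‖iteratedFDeriv ℝ m (R S) x‖ ≤ ε := by
  choose C hC0 hC using exists_bound_iteratedFDeriv_cosBasis_smul (ι := ι) (𝕜 := 𝕜)
  have hv : ∀ m, Summable fun n => C m * (‖cosCoeff f n‖ * freqWeight n ^ m) := fun m =>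
    (summable_norm_cosCoeff_mul hf hs m).mul_left _
  have hvS : ∀ m (S : Finset (ι → ℕ)), Summable fun n : {n // n ∉ S} =>
      C m * (‖cosCoeff f n‖ * freqWeight n.1 ^ m) := fun m S => (hv m).subtype _
  have hd : ∀ n : ι → ℕ, ContDiff ℝ ∞ fun x => cosBasis n x • cosCoeff f n := fun n =>
    (contDiff_cosBasis n).smul contDiff_const
  -- The remainder is the tail of the series. It agrees with `f` minus the partial sum only on the
  -- cube, but the tail is smooth and small on the whole space.
  refine ⟨fun S x => ∑' n : {n // n ∉ S}, cosBasis n.1 x • cosCoeff f n.1, fun S => ?_, fun S x hx => ?_,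
    fun m ε hε => ?_⟩
  · exact contDiff_tsum (N := ⊤) (fun n => hd n) (fun k _ => hvS k S) fun k n x _ => hC k n.1 _ x
  · have h := hasSum_cosCoeff hf hs hx
    rw [← h.tsum_eq, ← h.summable.sum_add_tsum_subtype_compl S]
    simp
  · have h0 := tendsto_tsum_compl_atTop_zero fun n => C m * (‖cosCoeff f n‖ * freqWeight n ^ m)
    filter_upwards [h0.eventually (gt_mem_nhds hε)] with S hS x
    rw [iteratedFDeriv_tsum_apply (N := ⊤) (fun n : {n // n ∉ S} => hd n.1) (fun k _ => hvS k S)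
      (fun k n x _ => hC k n.1 _ x) le_top]
    exact (tsum_of_norm_bounded (hvS m S).hasSum fun n => hC m n.1 _ x).trans hS.le

end Cosine

/-! ### Bounds for derivatives of products and compositions on compact sets -/

section Bounds

variable {V W F : Type*} [NormedAddCommGroup V] [NormedSpace ℝ V] [NormedAddCommGroup W]
  [NormedSpace ℝ W] [NormedAddCommGroup F] [NormedSpace ℝ F]

theorem exists_bound_iteratedFDeriv_of_isCompact {O K : Set V} (hO : IsOpen O) (hK : IsCompact K)
    (hKO : K ⊆ O) {f : V → F} (hf : ContDiffOn ℝ ∞ f O) (m : ℕ) :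
    ∃ A : ℝ, 1 ≤ A ∧ ∀ j ≤ m, ∀ y ∈ K, ‖iteratedFDeriv ℝ j f y‖ ≤ A := by
  have h : ∀ j : ℕ, ∃ A, ∀ y ∈ K, ‖iteratedFDeriv ℝ j f y‖ ≤ A := fun j =>
    hK.exists_bound_of_continuousOn fun y hy =>
      ((hf.contDiffAt (hO.mem_nhds (hKO hy))).continuousAt_iteratedFDeriv
        (by exact_mod_cast le_top)).continuousWithinAt
  choose A hA using h
  refine ⟨1 + ∑ j ∈ Finset.range (m + 1), |A j|,
    le_add_of_nonneg_right (Finset.sum_nonneg fun _ _ => abs_nonneg _), fun j hj y hy => ?_⟩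
  have := Finset.single_le_sum (f := fun j => |A j|)
    (fun _ _ => abs_nonneg _) (Finset.mem_range.2 (Nat.lt_succ_of_le hj))
  linarith [hA j y hy, le_abs_self (A j)]

/-- Faà di Bruno. The constant depends on `τ` only, and `A ≥ 1` allows the bound `A` for the `i`-th
derivative of `τ` to be replaced by the required `A ^ i`. -/
theorem exists_bound_iteratedFDeriv_comp {O K : Set V} (hO : IsOpen O) (hK : IsCompact K)
    (hKO : K ⊆ O) {τ : V → W} (hτ : ContDiffOn ℝ ∞ τ O) (m : ℕ) :
    ∃ C : ℝ, 0 ≤ C ∧ ∀ g : W → F, ContDiff ℝ ∞ g → ∀ B : ℝ, ∀ y ∈ K,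
      (∀ j ≤ m, ‖iteratedFDeriv ℝ j g (τ y)‖ ≤ B) →
        ∀ j ≤ m, ‖iteratedFDeriv ℝ j (g ∘ τ) y‖ ≤ C * B := by
  obtain ⟨A, hA1, hA⟩ := exists_bound_iteratedFDeriv_of_isCompact hO hK hKO hτ m
  refine ⟨m.factorial * A ^ m, by positivity, fun g hg B y hy hB j hj => ?_⟩
  have hB0 : 0 ≤ B := (norm_nonneg _).trans (hB 0 (Nat.zero_le _))
  have h := norm_iteratedFDerivWithin_comp_le (n := j) (x := y) hg.contDiffOn hτ
    (by exact_mod_cast le_top) uniqueDiffOn_univ hO.uniqueDiffOn (Set.mapsTo_univ _ _) (hKO hy)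
    (C := B) (D := A) (fun i hi => by
      rw [iteratedFDerivWithin_univ]
      exact hB i (hi.trans hj))
    (fun i hi hij => by
      rw [iteratedFDerivWithin_of_isOpen i hO (hKO hy)]
      exact (hA i (hij.trans hj) y hy).trans (le_self_pow₀ hA1 (by omega)))
  rw [iteratedFDerivWithin_of_isOpen j hO (hKO hy)] at h
  refine h.trans ?_
  rw [mul_right_comm]
  refine mul_le_mul_of_nonneg_right (mul_le_mul ?_ (pow_le_pow_right₀ hA1 hj) (by positivity)
    (by positivity)) hB0
  exact_mod_cast Nat.factorial_le hj

theorem exists_bound_iteratedFDeriv_smul {O K : Set V} (hO : IsOpen O) (hK : IsCompact K)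
    (hKO : K ⊆ O) {a : V → ℝ} (ha : ContDiffOn ℝ ∞ a O) (m : ℕ) :
    ∃ C : ℝ, 0 ≤ C ∧ ∀ g : V → F, ContDiffOn ℝ ∞ g O → ∀ B : ℝ, ∀ y ∈ K,
      (∀ j ≤ m, ‖iteratedFDeriv ℝ j g y‖ ≤ B) →
        ∀ j ≤ m, ‖iteratedFDeriv ℝ j (fun y => a y • g y) y‖ ≤ C * B := by
  obtain ⟨A, hA1, hA⟩ := exists_bound_iteratedFDeriv_of_isCompact hO hK hKO ha m
  refine ⟨2 ^ m * A, by positivity, fun g hg B y hy hB j hj => ?_⟩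
  have hB0 : 0 ≤ B := (norm_nonneg _).trans (hB 0 (Nat.zero_le _))
  have h := norm_iteratedFDerivWithin_smul_le (n := j) ha hg hO.uniqueDiffOn (hKO hy)
    (by exact_mod_cast le_top)
  rw [iteratedFDerivWithin_of_isOpen j hO (hKO hy)] at h
  refine h.trans ?_
  calc _ ≤ ∑ i ∈ Finset.range (j + 1), (j.choose i : ℝ) * (A * B) := by
        refine Finset.sum_le_sum fun i hi => ?_
        have hi' := Nat.lt_succ_iff.1 (Finset.mem_range.1 hi)
        rw [iteratedFDerivWithin_of_isOpen _ hO (hKO hy),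
          iteratedFDerivWithin_of_isOpen _ hO (hKO hy), mul_assoc]
        exact mul_le_mul_of_nonneg_left (mul_le_mul (hA i (hi'.trans hj) y hy)
          (hB (j - i) ((Nat.sub_le _ _).trans hj)) (norm_nonneg _) (by positivity))
          (Nat.cast_nonneg _)
    _ = 2 ^ j * (A * B) := by
        rw [← Finset.sum_mul]
        congr 1
        exact_mod_cast Nat.sum_range_choose j
    _ ≤ 2 ^ m * (A * B) := mul_le_mul_of_nonneg_right
        (pow_le_pow_right₀ one_le_two hj) (by positivity)
    _ = _ := by ring

end Bounds

/-! ### The topology of the space of smooth functions -/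

section SmoothFn

variable {𝕜 : Type*} [RCLike 𝕜] {V : Type*} [NormedAddCommGroup V] [NormedSpace ℝ V]
  {H : Type*} [TopologicalSpace H] {I : ModelWithCorners ℝ V H}
  {N : Type*} [TopologicalSpace N] [ChartedSpace H N] [I.Boundaryless] [IsManifold I ∞ N]

theorem SmoothFn.norm_iteratedFDeriv_le (f : SmoothFn 𝕜 I N) (c : ChartCompact I N) {j m : ℕ}
    (hj : j ≤ m) {y : V} (hy : y ∈ c.carrier) :
    ‖iteratedFDeriv ℝ j (f.inChart c.pt) y‖ ≤ chartSeminorm c m f := by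
  have h1 : ‖iteratedFDeriv ℝ j (f.inChart c.pt) y‖ ≤ derivSeminorm c j f :=
    le_ciSup (f.bddAbove c j) ⟨y, hy⟩
  exact h1.trans (Seminorm.le_finset_sup_apply (p := fun j => derivSeminorm (𝕜 := 𝕜) c j)
    (Finset.mem_range.2 (Nat.lt_succ_of_le hj)))

theorem chartSeminorm_le (c : ChartCompact I N) (m : ℕ) (f : SmoothFn 𝕜 I N) {B : ℝ} (hB : 0 ≤ B)
    (h : ∀ j ≤ m, ∀ y ∈ c.carrier, ‖iteratedFDeriv ℝ j (f.inChart c.pt) y‖ ≤ B) :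
    chartSeminorm c m f ≤ B :=
  Seminorm.finset_sup_apply_le hB fun j hj =>
    Real.iSup_le (fun y => h j (Nat.lt_succ_iff.1 (Finset.mem_range.1 hj)) y y.2) hB

theorem chartSeminorm_mono (c : ChartCompact I N) {m n : ℕ} (hmn : m ≤ n) (f : SmoothFn 𝕜 I N) :
    chartSeminorm c m f ≤ chartSeminorm c n f :=
  chartSeminorm_le c m f (apply_nonneg _ _) fun _ hj _ hy =>
    f.norm_iteratedFDeriv_le c (hj.trans hmn) hy

theorem SmoothFn.isTopologicalAddGroup : IsTopologicalAddGroup (SmoothFn 𝕜 I N) :=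
  topologicalAddGroup_iInf fun i =>
    letI := (chartSeminorm (𝕜 := 𝕜) (I := I) (N := N) i.1 i.2).toSeminormedAddCommGroup
    inferInstance

theorem SmoothFn.withSeminorms : WithSeminorms
    (fun i : ChartCompact I N × ℕ => chartSeminorm (𝕜 := 𝕜) i.1 i.2) := by
  have := SmoothFn.isTopologicalAddGroup (𝕜 := 𝕜) (I := I) (N := N)
  exact (SeminormFamily.withSeminorms_iff_topologicalSpace_eq_iInf _).2 rfl

instance : IsTopologicalAddGroup (SmoothFn 𝕜 I N) := SmoothFn.isTopologicalAddGroup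

instance : ContinuousSMul 𝕜 (SmoothFn 𝕜 I N) := SmoothFn.withSeminorms.continuousSMul

theorem continuous_chartSeminorm (c : ChartCompact I N) (m : ℕ) :
    Continuous (chartSeminorm (𝕜 := 𝕜) c m) :=
  SmoothFn.withSeminorms.continuous_seminorm (c, m)

/-- The sum of the `C^m`-seminorms over a finite set of compact subsets of charts. -/
def sumSeminorm (𝕜 : Type*) [RCLike 𝕜] (s : Finset (ChartCompact I N)) (m : ℕ) :
    Seminorm 𝕜 (SmoothFn 𝕜 I N) :=
  ∑ c ∈ s, chartSeminorm c m

theorem sumSeminorm_apply (s : Finset (ChartCompact I N)) (m : ℕ) (f : SmoothFn 𝕜 I N) :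
    sumSeminorm 𝕜 s m f = ∑ c ∈ s, chartSeminorm c m f := by
  classical
  unfold sumSeminorm
  induction s using Finset.induction_on with
  | empty => simp
  | insert a s ha ih => rw [Finset.sum_insert ha, Finset.sum_insert ha, add_apply, ih]

theorem chartSeminorm_le_sumSeminorm {s : Finset (ChartCompact I N)} {c : ChartCompact I N}
    (hc : c ∈ s) {m n : ℕ} (hmn : m ≤ n) (f : SmoothFn 𝕜 I N) :
    chartSeminorm c m f ≤ sumSeminorm 𝕜 s n f := by
  rw [sumSeminorm_apply]
  exact (chartSeminorm_mono c hmn f).trans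
    (Finset.single_le_sum (f := fun c => chartSeminorm c n f) (fun _ _ => apply_nonneg _ _) hc)

theorem continuous_sumSeminorm (s : Finset (ChartCompact I N)) (m : ℕ) :
    Continuous (sumSeminorm 𝕜 s m) := by
  have : ⇑(sumSeminorm 𝕜 s m) = fun f => ∑ c ∈ s, chartSeminorm c m f :=
    funext fun f => sumSeminorm_apply s m f
  rw [this]
  exact continuous_finsetSum s fun c _ => continuous_chartSeminorm c m

/-- The seminorms `sumSeminorm` are a directed family which defines the topology. -/
theorem SmoothFn.exists_le_sumSeminorm {p : Seminorm 𝕜 (SmoothFn 𝕜 I N)} (hp : Continuous p) :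
    ∃ (s : Finset (ChartCompact I N)) (m : ℕ) (C : ℝ), 0 ≤ C ∧ ∀ f, p f ≤ C * sumSeminorm 𝕜 s m f := by
  classical
  obtain ⟨s, C, -, hC⟩ := Seminorm.bound_of_continuous SmoothFn.withSeminorms p hp
  refine ⟨s.image Prod.fst, s.sup Prod.snd, C, C.2, fun f => (hC f).trans ?_⟩
  refine mul_le_mul_of_nonneg_left ?_ C.2
  exact Seminorm.finset_sup_apply_le (apply_nonneg _ _) fun i hi =>
    chartSeminorm_le_sumSeminorm (Finset.mem_image_of_mem _ hi) (Finset.le_sup (f := Prod.snd) hi) f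

theorem SmoothFn.tendsto_nhds {α : Type*} {l : Filter α} {u : α → SmoothFn 𝕜 I N}
    {f : SmoothFn 𝕜 I N} (h : ∀ (c : ChartCompact I N) (m : ℕ) (ε : ℝ), 0 < ε →
      ∀ᶠ x in l, chartSeminorm c m (f - u x) < ε) : Filter.Tendsto u l (𝓝 f) := by
  refine (SmoothFn.withSeminorms.tendsto_nhds u f).2 fun i ε hε => ?_
  filter_upwards [h i.1 i.2 ε hε] with x hx
  rwa [map_sub_rev]

/-- Vanishing on an open neighbourhood of the compact set makes the germ zero at each of its points,
so all derivatives vanish there too. -/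
theorem chartSeminorm_eq_zero {c : ChartCompact I N} {O : Set N} (hO : IsOpen O)
    (hcO : (extChartAt I c.pt).symm '' c.carrier ⊆ O) {f : SmoothFn 𝕜 I N} (hf : ∀ x ∈ O, f x = 0)
    (m : ℕ) : chartSeminorm c m f = 0 := by
  refine le_antisymm (chartSeminorm_le c m f le_rfl fun j _ y hy => ?_) (apply_nonneg _ _)
  have h : f.inChart c.pt =ᶠ[𝓝 y] 0 := by
    filter_upwards [(continuousAt_extChartAt_symm'' (c.subset hy)).preimage_mem_nhds
      (hO.mem_nhds (hcO ⟨y, hy, rfl⟩))] with z hz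
    exact hf _ hz
  rw [(h.iteratedFDeriv (𝕜 := ℝ) j).eq_of_nhds]
  simp

/-- Evaluation at a point. -/
def SmoothFn.eval (x : N) : SmoothFn 𝕜 I N →ₗ[𝕜] 𝕜 where
  toFun f := f x
  map_add' _ _ := rfl
  map_smul' _ _ := rfl

theorem SmoothFn.eval_apply (x : N) (f : SmoothFn 𝕜 I N) : SmoothFn.eval x f = f x := rfl

theorem SmoothFn.ext {f g : SmoothFn 𝕜 I N} (h : ∀ x, f x = g x) : f = g :=
  Subtype.ext (funext h)

/-! #### Multiplication by smooth real functions -/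

/-- The product of a real smooth function and a smooth function. -/
def SmoothFn.mulReal (a : N → ℝ) (ha : ContMDiff I 𝓘(ℝ, ℝ) ∞ a) :
    SmoothFn 𝕜 I N →ₗ[𝕜] SmoothFn 𝕜 I N where
  toFun f := ⟨fun x => a x • f x, ha.smul f.contMDiff⟩
  map_add' _ _ := Subtype.ext (funext fun _ => smul_add _ _ _)
  map_smul' c f := Subtype.ext (funext fun x => (mul_smul_comm (a x) c (f x)).symm)

@[simp] theorem SmoothFn.mulReal_apply {a : N → ℝ} (ha : ContMDiff I 𝓘(ℝ, ℝ) ∞ a)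
    (f : SmoothFn 𝕜 I N) (x : N) : SmoothFn.mulReal a ha f x = a x • f x := rfl

theorem exists_chartSeminorm_mulReal_le {a : N → ℝ} (ha : ContMDiff I 𝓘(ℝ, ℝ) ∞ a)
    (c : ChartCompact I N) (m : ℕ) : ∃ C : ℝ, 0 ≤ C ∧ ∀ f : SmoothFn 𝕜 I N,
      chartSeminorm c m (SmoothFn.mulReal a ha f) ≤ C * chartSeminorm c m f := by
  have ha' : ContDiffOn ℝ ∞ (SmoothFn.inChart (𝕜 := ℝ) ⟨a, ha⟩ c.pt) (extChartAt I c.pt).target :=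
    fun y hy => (SmoothFn.contDiffAt_inChart (𝕜 := ℝ) ⟨a, ha⟩ c.pt hy).contDiffWithinAt
  obtain ⟨C, hC0, hC⟩ := exists_bound_iteratedFDeriv_smul (F := 𝕜) (isOpen_extChartAt_target c.pt)
    c.isCompact c.subset ha' m
  refine ⟨C, hC0, fun f => chartSeminorm_le c m _ (mul_nonneg hC0 (apply_nonneg _ _))
    fun j hj y hy => ?_⟩
  exact hC (f.inChart c.pt) (fun y hy => (f.contDiffAt_inChart c.pt hy).contDiffWithinAt) _ y hy
    (fun j hj => f.norm_iteratedFDeriv_le c hj hy) j hj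

end SmoothFn

/-! ### Localization of smooth functions to a cube in a chart -/

section Localizer

open Filter

/-- A smooth cut-off function `χ` in the domain of a chart, together with a second cut-off `θ` which
is `1` where `χ` does not vanish, and affine coordinates which map the support of `θ` to the unit
cube. -/
structure Localizer {V : Type*} [NormedAddCommGroup V] [NormedSpace ℝ V] {H : Type*}
    [TopologicalSpace H] (I : ModelWithCorners ℝ V H) (N : Type*) [TopologicalSpace N]
    [ChartedSpace H N] (ι : Type*) [Fintype ι] where
  /-- the point at which the chart is centred -/
  pt : N
  /-- the linear part of the affine change of coordinates -/
  lin : V ≃L[ℝ] (ι → ℝ)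
  /-- the translation part of the affine change of coordinates -/
  shift : ι → ℝ
  /-- the cut-off function -/
  χ : N → ℝ
  /-- the larger cut-off function -/
  θ : N → ℝ
  smooth_χ : ContMDiff I 𝓘(ℝ, ℝ) ∞ χ
  smooth_θ : ContMDiff I 𝓘(ℝ, ℝ) ∞ θ
  isCompact_tsupport : IsCompact (tsupport θ)
  tsupport_subset : tsupport θ ⊆ (extChartAt I pt).source
  mem_unitCube : ∀ x ∈ tsupport θ, lin (extChartAt I pt x) + shift ∈ unitCube ι
  eq_one : ∀ x, χ x ≠ 0 → θ x = 1

namespace Localizer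

variable {V : Type*} [NormedAddCommGroup V] [NormedSpace ℝ V] {H : Type*} [TopologicalSpace H]
  {I : ModelWithCorners ℝ V H} {N : Type*} [TopologicalSpace N] [ChartedSpace H N]
  {ι : Type*} [Fintype ι] (Λ : Localizer I N ι)

theorem mem_tsupport {x : N} (hx : Λ.χ x ≠ 0) : x ∈ tsupport Λ.θ :=
  subset_tsupport _ (by rw [Function.mem_support, Λ.eq_one x hx]; exact one_ne_zero)

theorem tsupport_χ_subset : tsupport Λ.χ ⊆ tsupport Λ.θ :=
  closure_minimal (fun _ hx => Λ.mem_tsupport hx) (isClosed_tsupport _)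

/-- The coordinates of a point of `N`. -/
def coord (x : N) : ι → ℝ := Λ.lin (extChartAt I Λ.pt x) + Λ.shift

/-- The support of the larger cut-off function, as a compact subset of the chart. -/
def chartCompact : ChartCompact I N where
  pt := Λ.pt
  carrier := extChartAt I Λ.pt '' tsupport Λ.θ
  isCompact := Λ.isCompact_tsupport.image_of_continuousOn
    ((continuousOn_extChartAt Λ.pt).mono Λ.tsupport_subset)
  subset := by
    rintro _ ⟨x, hx, rfl⟩
    exact (extChartAt I Λ.pt).map_source (Λ.tsupport_subset hx)

variable {𝕜 : Type*} [RCLike 𝕜]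

open Classical in
/-- The function `θ f` in the chart, extended by zero. -/
def chartExt (f : N → 𝕜) (y : V) : 𝕜 :=
  if y ∈ (extChartAt I Λ.pt).target then
    Λ.θ ((extChartAt I Λ.pt).symm y) • f ((extChartAt I Λ.pt).symm y) else 0

/-- The function `θ f` in the affine coordinates, extended by zero. -/
def toCube (f : N → 𝕜) (z : ι → ℝ) : 𝕜 := Λ.chartExt f (Λ.lin.symm (z - Λ.shift))

theorem chartExt_eq_zero (f : N → 𝕜) {y : V} (hy : y ∉ Λ.chartCompact.carrier) :
    Λ.chartExt f y = 0 := by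
  unfold chartExt
  split_ifs with h
  · rw [image_eq_zero_of_notMem_tsupport (f := Λ.θ), zero_smul]
    exact fun hx => hy ⟨_, hx, (extChartAt I Λ.pt).right_inv h⟩
  · rfl

theorem toCube_coord (f : N → 𝕜) {x : N} (hx : x ∈ tsupport Λ.θ) :
    Λ.toCube f (Λ.coord x) = Λ.θ x • f x := by
  have hs := Λ.tsupport_subset hx
  rw [toCube, coord, add_sub_cancel_right, ContinuousLinearEquiv.symm_apply_apply, chartExt,
    if_pos ((extChartAt I Λ.pt).map_source hs), (extChartAt I Λ.pt).left_inv hs]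

theorem tsupport_toCube_subset (f : N → 𝕜) : tsupport (Λ.toCube f) ⊆ unitCube ι := by
  refine closure_minimal (fun z hz => ?_) isCompact_unitCube.isClosed
  by_contra hcon
  refine hz (Λ.chartExt_eq_zero f ?_)
  rintro ⟨x, hx, hxz⟩
  refine hcon ?_
  have := Λ.mem_unitCube x hx
  rwa [hxz, ContinuousLinearEquiv.apply_symm_apply, sub_add_cancel] at this

theorem chartExt_add (f g : N → 𝕜) : Λ.chartExt (f + g) = Λ.chartExt f + Λ.chartExt g := by
  funext y
  simp only [chartExt, Pi.add_apply]
  split_ifs <;> simp [smul_add]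

theorem chartExt_smul (c : 𝕜) (f : N → 𝕜) : Λ.chartExt (c • f) = c • Λ.chartExt f := by
  funext y
  simp only [chartExt, Pi.smul_apply]
  split_ifs <;> simp

variable [I.Boundaryless] [IsManifold I ∞ N]

/-- Outside the target of the chart, a point has a neighbourhood disjoint from the compact image of
the support of `θ`, where the extension is zero. -/
theorem contDiff_chartExt (f : SmoothFn 𝕜 I N) : ContDiff ℝ ∞ (Λ.chartExt f) := by
  rw [contDiff_iff_contDiffAt]
  intro y
  by_cases hy : y ∈ (extChartAt I Λ.pt).target
  · refine ((SmoothFn.mulReal Λ.θ Λ.smooth_θ f).contDiffAt_inChart Λ.pt hy).congr_of_eventuallyEq ?_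
    filter_upwards [(isOpen_extChartAt_target Λ.pt).mem_nhds hy] with z hz
    rw [chartExt, if_pos hz]
    rfl
  · have : Λ.chartExt f =ᶠ[𝓝 y] fun _ => 0 := by
      filter_upwards [Λ.chartCompact.isCompact.isClosed.isOpen_compl.mem_nhds
        fun h => hy (Λ.chartCompact.subset h)] with z hz
      exact Λ.chartExt_eq_zero f hz
    exact contDiffAt_const.congr_of_eventuallyEq this

theorem contDiff_toCube (f : SmoothFn 𝕜 I N) : ContDiff ℝ ∞ (Λ.toCube f) := by
  have h : ContDiff ℝ ∞ fun z : ι → ℝ => Λ.lin.symm (z - Λ.shift) :=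
    Λ.lin.symm.contDiff.comp (contDiff_id.sub contDiff_const)
  exact (Λ.contDiff_chartExt f).comp h

/-- The derivatives of `θ f` in the affine coordinates are bounded by a seminorm of `f`. -/
theorem exists_bound_iteratedFDeriv_toCube (m : ℕ) : ∃ C : ℝ, 0 ≤ C ∧ ∀ f : SmoothFn 𝕜 I N,
    ∀ j ≤ m, ∀ z ∈ unitCube ι,
      ‖iteratedFDeriv ℝ j (Λ.toCube f) z‖ ≤ C * chartSeminorm Λ.chartCompact m f := by
  have h : ContDiff ℝ ∞ fun z : ι → ℝ => Λ.lin.symm (z - Λ.shift) :=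
    Λ.lin.symm.contDiff.comp (contDiff_id.sub contDiff_const)
  obtain ⟨C₁, hC₁, h₁⟩ := exists_bound_iteratedFDeriv_comp (F := 𝕜) isOpen_univ isCompact_unitCube
    (Set.subset_univ _) h.contDiffOn m
  obtain ⟨C₂, hC₂, h₂⟩ := exists_chartSeminorm_mulReal_le (𝕜 := 𝕜) Λ.smooth_θ Λ.chartCompact m
  refine ⟨C₁ * C₂, mul_nonneg hC₁ hC₂, fun f j hj z hz => ?_⟩
  rw [mul_assoc]
  refine h₁ (Λ.chartExt f) (Λ.contDiff_chartExt f) _ z hz (fun j hj => ?_) j hj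
  refine le_trans ?_ (h₂ f)
  set y := Λ.lin.symm (z - Λ.shift)
  by_cases hy : y ∈ Λ.chartCompact.carrier
  · have : Λ.chartExt f =ᶠ[𝓝 y] (SmoothFn.mulReal Λ.θ Λ.smooth_θ f).inChart Λ.chartCompact.pt := by
      filter_upwards [(isOpen_extChartAt_target Λ.pt).mem_nhds (Λ.chartCompact.subset hy)] with z hz
      rw [chartExt, if_pos hz]
      rfl
    rw [(this.iteratedFDeriv (𝕜 := ℝ) j).eq_of_nhds]
    exact SmoothFn.norm_iteratedFDeriv_le _ _ hj hy
  · have : Λ.chartExt f =ᶠ[𝓝 y] 0 := by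
      filter_upwards [Λ.chartCompact.isCompact.isClosed.isOpen_compl.mem_nhds hy] with z hz
      exact Λ.chartExt_eq_zero f hz
    rw [(this.iteratedFDeriv (𝕜 := ℝ) j).eq_of_nhds]
    simp

/-! #### Coefficients -/

/-- The coefficients of the cosine series of `θ f`. -/
def coeff (n : ι → ℕ) : SmoothFn 𝕜 I N →ₗ[𝕜] 𝕜 where
  toFun f := cosCoeff (Λ.toCube f) n
  map_add' f g := by
    have hint : ∀ f : SmoothFn 𝕜 I N,
        MeasureTheory.Integrable fun z => cosBasis n z • Λ.toCube f z := fun f =>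
      ((continuous_cosBasis n).smul (Λ.contDiff_toCube f).continuous).integrable_of_hasCompactSupport
        (HasCompactSupport.smul_left (f' := Λ.toCube f) (isCompact_unitCube.of_isClosed_subset
          (isClosed_tsupport _) (Λ.tsupport_toCube_subset f)))
    simp only [cosCoeff]
    rw [← smul_add, ← MeasureTheory.integral_add (hint f) (hint g)]
    congr 2
    funext z
    rw [← smul_add]
    exact congrArg (cosBasis n z • ·) (congrFun (Λ.chartExt_add f g) _)
  map_smul' c f := by
    simp only [cosCoeff, RingHom.id_apply]
    rw [smul_comm c (cosNormalizer n), ← MeasureTheory.integral_smul c]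
    congr 2
    funext z
    rw [smul_comm c (cosBasis n z)]
    exact congrArg (cosBasis n z • ·) (congrFun (Λ.chartExt_smul c f) _)

theorem coeff_apply (n : ι → ℕ) (f : SmoothFn 𝕜 I N) : Λ.coeff n f = cosCoeff (Λ.toCube f) n := rfl

/-- The coefficients see only the support of `θ`; this confines the support of the kernel. -/
theorem coeff_eq_zero {f : SmoothFn 𝕜 I N} (hf : ∀ x ∈ tsupport Λ.θ, f x = 0) (n : ι → ℕ) :
    Λ.coeff n f = 0 := by
  have : ∀ z, Λ.toCube f z = 0 := by
    intro z
    by_cases hy : Λ.lin.symm (z - Λ.shift) ∈ Λ.chartCompact.carrier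
    · obtain ⟨x, hx, hxz⟩ := hy
      rw [toCube, ← hxz, chartExt, if_pos ((extChartAt I Λ.pt).map_source (Λ.tsupport_subset hx)),
        (extChartAt I Λ.pt).left_inv (Λ.tsupport_subset hx), hf x hx, smul_zero]
    · exact Λ.chartExt_eq_zero f hy
  simp [coeff_apply, cosCoeff, this]

theorem exists_norm_coeff_le (N' : ℕ) : ∃ C : ℝ, 0 ≤ C ∧ ∀ (f : SmoothFn 𝕜 I N) (n : ι → ℕ),
    ‖Λ.coeff n f‖ ≤ C * chartSeminorm Λ.chartCompact (2 * N') f / freqWeight n ^ (2 * N') := by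
  obtain ⟨C, hC, h⟩ := Λ.exists_bound_iteratedFDeriv_toCube (𝕜 := 𝕜) (2 * N')
  refine ⟨2 ^ Fintype.card ι * (Fintype.card ι + 1) ^ (2 * N') * C, by positivity, fun f n => ?_⟩
  rw [coeff_apply, mul_assoc _ C]
  exact norm_cosCoeff_le (Λ.contDiff_toCube f) (Λ.tsupport_toCube_subset f) (h f) n

/-! #### Smooth functions from the cube to the manifold -/

theorem contMDiff_fromCube {g : (ι → ℝ) → 𝕜} (hg : ContDiff ℝ ∞ g) :
    ContMDiff I 𝓘(ℝ, 𝕜) ∞ fun x => Λ.χ x • g (Λ.coord x) := by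
  refine contMDiff_of_tsupport fun x hx => ?_
  have hx' : x ∈ (extChartAt I Λ.pt).source :=
    Λ.tsupport_subset (Λ.tsupport_χ_subset (tsupport_smul_subset_left _ _ hx))
  have hext : ContMDiffAt I 𝓘(ℝ, V) ∞ (extChartAt I Λ.pt) x :=
    contMDiffAt_extChartAt' (by rwa [extChartAt_source] at hx')
  have h : ContDiff ℝ ∞ fun y : V => g (Λ.lin y + Λ.shift) :=
    hg.comp (Λ.lin.contDiff.add contDiff_const)
  exact Λ.smooth_χ.contMDiffAt.smul (h.contMDiff.contMDiffAt.comp x hext)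

/-- The function `χ g` on the manifold, for a smooth function `g` of the affine coordinates. -/
def fromCube (g : (ι → ℝ) → 𝕜) (hg : ContDiff ℝ ∞ g) : SmoothFn 𝕜 I N :=
  ⟨fun x => Λ.χ x • g (Λ.coord x), Λ.contMDiff_fromCube hg⟩

theorem fromCube_apply (g : (ι → ℝ) → 𝕜) (hg : ContDiff ℝ ∞ g) (x : N) :
    Λ.fromCube g hg x = Λ.χ x • g (Λ.coord x) := rfl

/-- The topology of `C^∞` involves every chart, not just that of `Λ`. On the compact part of `c`
that meets the support of `χ`, the change of coordinates is smooth and the chain and Leibniz rules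
apply; elsewhere the function is locally zero. -/
theorem exists_chartSeminorm_fromCube_le (c : ChartCompact I N) (m : ℕ) : ∃ C : ℝ, 0 ≤ C ∧
    ∀ (g : (ι → ℝ) → 𝕜) (hg : ContDiff ℝ ∞ g) (B : ℝ), (∀ j ≤ m, ∀ z, ‖iteratedFDeriv ℝ j g z‖ ≤ B) →
      chartSeminorm c m (Λ.fromCube g hg) ≤ C * B := by
  set T := (extChartAt I c.pt).target
  set σ := (extChartAt I c.pt).symm
  have hTo : IsOpen T := isOpen_extChartAt_target c.pt
  have hσ : ContinuousOn σ T := continuousOn_extChartAt_symm c.pt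
  set O : Set V := T ∩ σ ⁻¹' (extChartAt I Λ.pt).source
  have hO : IsOpen O := hσ.isOpen_inter_preimage hTo (isOpen_extChartAt_source Λ.pt)
  set K : Set V := c.carrier ∩ σ ⁻¹' tsupport Λ.χ
  have hK : IsCompact K := c.isCompact.of_isClosed_subset
    ((hσ.mono c.subset).preimage_isClosed_of_isClosed c.isCompact.isClosed (isClosed_tsupport _))
    Set.inter_subset_left
  have hKO : K ⊆ O := fun y hy =>
    ⟨c.subset hy.1, Λ.tsupport_subset (Λ.tsupport_χ_subset hy.2)⟩
  have hσs : ContMDiffOn 𝓘(ℝ, V) I ∞ σ T := contMDiffOn_extChartAt_symm c.pt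
  have hτ : ContDiffOn ℝ ∞ (fun y => Λ.coord (σ y)) O := by
    have h1 : ContMDiffOn 𝓘(ℝ, V) 𝓘(ℝ, V) ∞ (extChartAt I Λ.pt ∘ σ) O :=
      (contMDiffOn_extChartAt (x := Λ.pt)).comp (hσs.mono Set.inter_subset_left)
        fun y hy => by have := hy.2; rwa [Set.mem_preimage, extChartAt_source] at this
    exact (Λ.lin.contDiff.comp_contDiffOn h1.contDiffOn).add contDiffOn_const
  have hχ : ContDiffOn ℝ ∞ (fun y => Λ.χ (σ y)) O :=
    fun y hy => (SmoothFn.contDiffAt_inChart (𝕜 := ℝ) ⟨Λ.χ, Λ.smooth_χ⟩ c.pt hy.1).contDiffWithinAt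
  obtain ⟨C₁, hC₁, h₁⟩ := exists_bound_iteratedFDeriv_comp (F := 𝕜) hO hK hKO hτ m
  obtain ⟨C₂, hC₂, h₂⟩ := exists_bound_iteratedFDeriv_smul (F := 𝕜) hO hK hKO hχ m
  refine ⟨C₂ * C₁, mul_nonneg hC₂ hC₁, fun g hg B hB => ?_⟩
  have hB0 : 0 ≤ B := (norm_nonneg _).trans (hB 0 (Nat.zero_le _) 0)
  refine chartSeminorm_le c m _ (by positivity) fun j hj y hy => ?_
  by_cases hyK : σ y ∈ tsupport Λ.χ
  · rw [mul_assoc]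
    exact h₂ (g ∘ fun y => Λ.coord (σ y)) (hg.comp_contDiffOn hτ) _ y ⟨hy, hyK⟩
      (h₁ g hg B y ⟨hy, hyK⟩ fun j hj => hB j hj _) j hj
  · have : (Λ.fromCube g hg).inChart c.pt =ᶠ[𝓝 y] 0 := by
      filter_upwards [(hσ.continuousAt (hTo.mem_nhds (c.subset hy))).preimage_mem_nhds
        ((isClosed_tsupport Λ.χ).isOpen_compl.mem_nhds hyK)] with z hz
      change Λ.χ (σ z) • _ = _
      rw [image_eq_zero_of_notMem_tsupport hz, zero_smul]
      rfl
    rw [(this.iteratedFDeriv (𝕜 := ℝ) j).eq_of_nhds]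
    simpa using mul_nonneg (mul_nonneg hC₂ hC₁) hB0

/-- The cosine products, transported to the manifold and cut off by `χ`. -/
def basis (𝕜 : Type*) [RCLike 𝕜] (n : ι → ℕ) : SmoothFn 𝕜 I N :=
  Λ.fromCube (fun z => cosBasis n z • (1 : 𝕜)) ((contDiff_cosBasis n).smul contDiff_const)

theorem basis_apply (n : ι → ℕ) (x : N) :
    Λ.basis 𝕜 n x = Λ.χ x • cosBasis n (Λ.coord x) • (1 : 𝕜) := rfl

theorem exists_chartSeminorm_basis_le (c : ChartCompact I N) (m : ℕ) : ∃ C : ℝ, 0 ≤ C ∧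
    ∀ n : ι → ℕ, chartSeminorm c m (Λ.basis 𝕜 n) ≤ C * freqWeight n ^ m := by
  obtain ⟨C, hC, h⟩ := Λ.exists_chartSeminorm_fromCube_le (𝕜 := 𝕜) c m
  choose D hD0 hD using exists_bound_iteratedFDeriv_cosBasis_smul (ι := ι) (𝕜 := 𝕜)
  have hsum : 0 ≤ ∑ j ∈ Finset.range (m + 1), D j := Finset.sum_nonneg fun _ _ => hD0 _
  refine ⟨C * ∑ j ∈ Finset.range (m + 1), D j, mul_nonneg hC hsum, fun n => ?_⟩
  rw [mul_assoc]
  refine h _ _ _ fun j hj z => (hD j n 1 z).trans ?_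
  rw [norm_one, one_mul]
  exact mul_le_mul (Finset.single_le_sum (f := D) (fun _ _ => hD0 _)
    (Finset.mem_range.2 (Nat.lt_succ_of_le hj)))
    (pow_le_pow_right₀ (one_le_freqWeight n) hj) (pow_nonneg (freqWeight_pos n).le _) hsum

/-- The localization `χ f` is the sum of its cosine series in the space of smooth functions. -/
theorem hasSum_coeff_smul_basis (f : SmoothFn 𝕜 I N) :
    HasSum (fun n => Λ.coeff n f • Λ.basis 𝕜 n) (SmoothFn.mulReal Λ.χ Λ.smooth_χ f) := by
  obtain ⟨R, hR, hR', hR0⟩ := exists_cosSeries_remainder (Λ.contDiff_toCube f)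
    (Λ.tsupport_toCube_subset f)
  refine SmoothFn.tendsto_nhds fun c m ε hε => ?_
  obtain ⟨C, hC, h⟩ := Λ.exists_chartSeminorm_fromCube_le (𝕜 := 𝕜) c m
  have hev : ∀ᶠ S in atTop, ∀ j ∈ Finset.range (m + 1), ∀ z,
      ‖iteratedFDeriv ℝ j (R S) z‖ ≤ ε / (2 * (C + 1)) :=
    (Finset.eventually_all _).2 fun j _ => hR0 j _ (by positivity)
  filter_upwards [hev] with S hS
  -- Where `χ` is nonzero, `θ = 1` and the coordinates lie in the cube, so there the remainder
  -- really is `f` minus the partial sum; where `χ` vanishes, both sides do.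
  have heq : SmoothFn.mulReal Λ.χ Λ.smooth_χ f - ∑ n ∈ S, Λ.coeff n f • Λ.basis 𝕜 n =
      Λ.fromCube (R S) (hR S) := by
    refine SmoothFn.ext fun x => ?_
    rw [← SmoothFn.eval_apply, map_sub, map_sum, fromCube_apply]
    simp_rw [map_smul, SmoothFn.eval_apply, basis_apply, SmoothFn.mulReal_apply]
    by_cases hx : Λ.χ x = 0
    · simp [hx]
    · have hx' := Λ.mem_tsupport hx
      rw [hR' S (Λ.coord x) (Λ.mem_unitCube x hx'), Λ.toCube_coord f hx', Λ.eq_one x hx, one_smul, smul_sub,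
        Finset.smul_sum]
      congr 1
      refine Finset.sum_congr rfl fun n _ => ?_
      rw [← coeff_apply, smul_eq_mul, mul_smul_comm, mul_smul_comm, mul_one]
  rw [heq]
  refine (h _ _ _ fun j hj z => hS j (Finset.mem_range.2 (Nat.lt_succ_of_le hj)) z).trans_lt ?_
  rw [mul_div_assoc', div_lt_iff₀ (by positivity)]
  nlinarith

end Localizer

end Localizer

section Localizer

open Filter

namespace Localizer

/-! #### Partitions of unity near a compact set -/

section Partition

variable {V : Type*} [NormedAddCommGroup V] [NormedSpace ℝ V] {H : Type*} [TopologicalSpace H]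
  {I : ModelWithCorners ℝ V H} {N : Type*} [TopologicalSpace N] [ChartedSpace H N]
  {ι : Type*} [Fintype ι]

/-- Multiply the cut-off function by a smooth function. -/
def cut (Λ : Localizer I N ι) (a : N → ℝ) (ha : ContMDiff I 𝓘(ℝ, ℝ) ∞ a) : Localizer I N ι where
  pt := Λ.pt
  lin := Λ.lin
  shift := Λ.shift
  χ x := a x * Λ.χ x
  θ := Λ.θ
  smooth_χ := ha.smul Λ.smooth_χ
  smooth_θ := Λ.smooth_θ
  isCompact_tsupport := Λ.isCompact_tsupport
  tsupport_subset := Λ.tsupport_subset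
  mem_unitCube := Λ.mem_unitCube
  eq_one x hx := Λ.eq_one x (right_ne_zero_of_mul hx)

variable [FiniteDimensional ℝ V] [T2Space N] [I.Boundaryless] [IsManifold I ∞ N]

/-- Two nested bump functions: `θ` is supported where the coordinates lie in the cube, and `χ` where
`θ = 1`. The shift puts `x` at the centre of the cube. -/
theorem exists_eventually_χ_eq_one (L : V ≃L[ℝ] (ι → ℝ)) (x : N) :
    ∃ Λ : Localizer I N ι, ∀ᶠ y in 𝓝 x, Λ.χ y = 1 := by
  set t : ι → ℝ := (fun _ => 1 / 2) - L (extChartAt I x x)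
  have hcube : {y | L (extChartAt I x y) + t ∈ unitCube ι} ∈ 𝓝 x := by
    have hc : ContinuousAt (fun y => L (extChartAt I x y) + t) x :=
      (L.continuous.continuousAt.comp (continuousAt_extChartAt x)).add continuousAt_const
    refine hc.preimage_mem_nhds ?_
    rw [unitCube, add_sub_cancel]
    exact set_pi_mem_nhds Set.finite_univ fun i _ => Icc_mem_nhds (by norm_num) (by norm_num)
  obtain ⟨θ, -, hθ⟩ := (SmoothBumpFunction.nhds_basis_tsupport (I := I) x).mem_iff.1 hcube
  obtain ⟨χ, -, hχ⟩ := (SmoothBumpFunction.nhds_basis_tsupport (I := I) x).mem_iff.1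
    θ.eventuallyEq_one
  exact ⟨{
    pt := x
    lin := L
    shift := t
    χ := χ
    θ := θ
    smooth_χ := χ.contMDiff
    smooth_θ := θ.contMDiff
    isCompact_tsupport := θ.hasCompactSupport
    tsupport_subset := θ.tsupport_subset_extChartAt_source
    mem_unitCube := fun y hy => hθ hy
    eq_one := fun y hy => hχ (subset_tsupport _ hy) }, χ.eventuallyEq_one⟩

/-- Induction on compact sets. If `σ` and `σ'` are the sums for two sets, cutting the second family
by `1 - σ` gives the sum `σ + (1 - σ) σ' = 1 - (1 - σ) (1 - σ')`, which is `1` wherever either is.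
-/
theorem exists_sum_χ_eq_one (L : V ≃L[ℝ] (ι → ℝ)) {K : Set N} (hK : IsCompact K) :
    ∃ (A : Type) (_ : Fintype A) (Λ : A → Localizer I N ι) (O : Set N), IsOpen O ∧ K ⊆ O ∧
      ∀ x ∈ O, ∑ a, (Λ a).χ x = 1 := by
  refine hK.induction_on (p := fun K => ∃ (A : Type) (_ : Fintype A) (Λ : A → Localizer I N ι)
    (O : Set N), IsOpen O ∧ K ⊆ O ∧ ∀ x ∈ O, ∑ a, (Λ a).χ x = 1) ?_ ?_ ?_ ?_
  · exact ⟨Empty, inferInstance, Empty.elim, ∅, isOpen_empty, le_rfl, fun _ h => h.elim⟩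
  · rintro s t hst ⟨A, hA, Λ, O, hO, htO, h⟩
    exact ⟨A, hA, Λ, O, hO, hst.trans htO, h⟩
  · rintro s t ⟨A, hA, Λ, O, hO, hsO, h⟩ ⟨A', hA', Λ', O', hO', htO', h'⟩
    have ha : ContMDiff I 𝓘(ℝ, ℝ) ∞ fun x => 1 - ∑ a, (Λ a).χ x :=
      contMDiff_const.sub (contMDiff_finsetSum fun a _ => (Λ a).smooth_χ)
    refine ⟨A ⊕ A', inferInstance, Sum.elim Λ fun a => (Λ' a).cut _ ha, O ∪ O', hO.union hO',
      Set.union_subset_union hsO htO', fun x hx => ?_⟩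
    rw [Fintype.sum_sum_type]
    have : ∑ a, ((Λ' a).cut _ ha).χ x = (1 - ∑ a, (Λ a).χ x) * ∑ a, (Λ' a).χ x := by
      rw [Finset.mul_sum]; rfl
    simp only [Sum.elim_inl, Sum.elim_inr]
    rw [this]
    rcases hx with hx | hx
    · rw [h x hx]; ring
    · rw [h' x hx]; ring
  · intro x _
    obtain ⟨Λ, hΛ⟩ := exists_eventually_χ_eq_one (I := I) L x
    obtain ⟨O, hO, hOo, hxO⟩ := eventually_nhds_iff.1 hΛ
    exact ⟨O, mem_nhdsWithin_of_mem_nhds (hOo.mem_nhds hxO), Unit, inferInstance, fun _ => Λ, O, hOo,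
      le_rfl, fun y hy => by simpa using hO y hy⟩

end Partition

/-! #### Products of localizers -/

section Prod

variable {V : Type*} [NormedAddCommGroup V] [NormedSpace ℝ V] {H : Type*} [TopologicalSpace H]
  {I : ModelWithCorners ℝ V H} {M : Type*} [TopologicalSpace M] [ChartedSpace H M]
  {ι : Type*} [Fintype ι] [IsManifold I ∞ M] {k : ℕ}

/-- Products of linear coordinates are linear coordinates. -/
def piLin (L : Fin k → V ≃L[ℝ] (ι → ℝ)) : (Fin k → V) ≃L[ℝ] (Fin k × ι → ℝ) where
  toFun y p := L p.1 (y p.1) p.2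
  invFun z i := (L i).symm fun j => z (i, j)
  left_inv y := by funext i; exact (L i).symm_apply_apply (y i)
  right_inv z := by funext p; simp
  map_add' y z := by funext p; simp
  map_smul' c y := by funext p; simp
  continuous_toFun := by fun_prop
  continuous_invFun := by fun_prop

theorem contMDiff_prod_apply (f : Fin k → M → ℝ) (hf : ∀ i, ContMDiff I 𝓘(ℝ, ℝ) ∞ (f i)) :
    ContMDiff (ModelWithCorners.pi fun _ : Fin k => I) 𝓘(ℝ, ℝ) ∞
      fun x : Fin k → M => ∏ i, f i (x i) :=
  (SmoothFn.tensor (𝕜 := ℝ) (I := I) (N := M) fun i => ⟨f i, hf i⟩).contMDiff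

theorem tsupport_prod_apply_subset (f : Fin k → M → ℝ) :
    tsupport (fun x : Fin k → M => ∏ i, f i (x i)) ⊆ Set.univ.pi fun i => tsupport (f i) := by
  refine closure_minimal (fun x hx i _ => subset_tsupport _ ?_)
    (isClosed_set_pi fun i _ => isClosed_tsupport _)
  exact fun h => hx (Finset.prod_eq_zero (Finset.mem_univ i) h)

/-- The product of localizers. -/
def pi (Λ : Fin k → Localizer I M ι) :
    Localizer (ModelWithCorners.pi fun _ : Fin k => I) (Fin k → M) (Fin k × ι) where
  pt i := (Λ i).pt
  lin := piLin fun i => (Λ i).lin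
  shift p := (Λ p.1).shift p.2
  χ x := ∏ i, (Λ i).χ (x i)
  θ x := ∏ i, (Λ i).θ (x i)
  smooth_χ := contMDiff_prod_apply _ fun i => (Λ i).smooth_χ
  smooth_θ := contMDiff_prod_apply _ fun i => (Λ i).smooth_θ
  isCompact_tsupport := (isCompact_univ_pi fun i => (Λ i).isCompact_tsupport).of_isClosed_subset
    (isClosed_tsupport _) (tsupport_prod_apply_subset _)
  tsupport_subset x hx := by
    have h : ∀ i, x i ∈ (extChartAt I (Λ i).pt).source := fun i =>
      (Λ i).tsupport_subset (tsupport_prod_apply_subset _ hx i trivial)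
    simp only [extChartAt_source] at h ⊢
    exact fun i _ => h i
  mem_unitCube x hx p _ :=
    (Λ p.1).mem_unitCube _ (tsupport_prod_apply_subset _ hx p.1 trivial) p.2 trivial
  eq_one x hx := Finset.prod_eq_one fun i _ => (Λ i).eq_one _
    fun h => hx (Finset.prod_eq_zero (Finset.mem_univ i) h)

variable {𝕜 : Type*} [RCLike 𝕜] [I.Boundaryless]

/-- The cosine products on `M^k` are elementary tensors, so a distribution on `M^k` is tested on
them through tensors alone. -/
theorem basis_pi (Λ : Fin k → Localizer I M ι) (n : Fin k × ι → ℕ) :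
    (pi Λ).basis 𝕜 n = SmoothFn.tensor fun i => (Λ i).basis 𝕜 fun j => n (i, j) := by
  refine SmoothFn.ext fun x => ?_
  change (∏ i, (Λ i).χ (x i)) • (∏ p : Fin k × ι, Real.cos (Real.pi * n p * (Λ p.1).coord (x p.1) p.2))
    • (1 : 𝕜) = ∏ i, (Λ i).χ (x i) • (∏ j, Real.cos (Real.pi * n (i, j) * (Λ i).coord (x i) j)) • (1 : 𝕜)
  rw [Fintype.prod_prod_type]
  simp only [Algebra.smul_def, mul_one, Finset.prod_mul_distrib, map_prod]

theorem chartExt_pi_tensor (Λ : Fin k → Localizer I M ι) (v : Fin k → SmoothFn 𝕜 I M)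
    (y : Fin k → V) :
    (pi Λ).chartExt (SmoothFn.tensor v) y = ∏ i, (Λ i).chartExt (v i) (y i) := by
  have hmem : y ∈ (extChartAt (ModelWithCorners.pi fun _ : Fin k => I) (pi Λ).pt).target ↔
      ∀ i, y i ∈ (extChartAt I (Λ i).pt).target := by
    simp only [extChartAt_target, ModelWithCorners.range_eq_univ, Set.inter_univ]
    exact ⟨fun h i => h i trivial, fun h i _ => h i⟩
  by_cases h : ∀ i, y i ∈ (extChartAt I (Λ i).pt).target
  · simp only [chartExt]
    rw [if_pos (hmem.2 h)]
    simp_rw [if_pos (h _)]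
    change (∏ i, (Λ i).θ ((extChartAt I (Λ i).pt).symm (y i))) •
      (∏ i, v i ((extChartAt I (Λ i).pt).symm (y i))) = _
    simp only [Algebra.smul_def, Finset.prod_mul_distrib, map_prod]
  · rw [chartExt, if_neg (mt hmem.1 h)]
    push Not at h
    obtain ⟨i, hi⟩ := h
    rw [Finset.prod_eq_zero (Finset.mem_univ i)]
    rw [chartExt, if_neg hi]

open MeasureTheory in
theorem measurePreserving_curry : MeasurePreserving (MeasurableEquiv.curry (Fin k) ι ℝ) := by
  refine MeasurePreserving.symm (MeasurableEquiv.curry (Fin k) ι ℝ).symm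
    ⟨(MeasurableEquiv.curry (Fin k) ι ℝ).symm.measurable, ?_⟩
  rw [volume_pi (ι := Fin k × ι)]
  refine (Measure.pi_eq fun s _ => ?_).symm
  rw [MeasurableEquiv.map_apply]
  have : (MeasurableEquiv.curry (Fin k) ι ℝ).symm ⁻¹' Set.univ.pi s =
      Set.univ.pi fun i => Set.univ.pi fun j => s (i, j) := by
    ext z
    simp only [Set.mem_preimage, Set.mem_univ_pi]
    exact ⟨fun h i j => h (i, j), fun h p => h p.1 p.2⟩
  rw [this, volume_pi_pi, Fintype.prod_prod_type]
  simp_rw [volume_pi_pi]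

/-- Fubini, after identifying `ℝ^(k × ι)` with `(ℝ^ι)^k`. -/
theorem coeff_pi_tensor (Λ : Fin k → Localizer I M ι) (v : Fin k → SmoothFn 𝕜 I M)
    (n : Fin k × ι → ℕ) :
    (pi Λ).coeff n (SmoothFn.tensor v) = ∏ i, (Λ i).coeff (fun j => n (i, j)) (v i) := by
  simp only [coeff_apply, cosCoeff]
  have h1 : cosNormalizer n = ∏ i, cosNormalizer fun j => n (i, j) := by
    simp only [cosNormalizer, Fintype.prod_prod_type]
  have h2 : ∫ z, cosBasis n z • (pi Λ).toCube (SmoothFn.tensor v) z =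
      ∏ i, ∫ z, (cosBasis fun j => n (i, j)) z • (Λ i).toCube (v i) z := by
    rw [← MeasureTheory.integral_fintype_prod_volume_eq_prod (𝕜 := 𝕜)
      fun i z => (cosBasis fun j => n (i, j)) z • (Λ i).toCube (v i) z,
      ← measurePreserving_curry.integral_comp']
    congr 1
    funext z
    rw [toCube, chartExt_pi_tensor, cosBasis, Fintype.prod_prod_type]
    simp only [cosBasis, Algebra.smul_def, Finset.prod_mul_distrib, map_prod]
    rfl
  rw [h1, h2]
  simp only [Algebra.smul_def, Finset.prod_mul_distrib, map_prod]

end Prod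

end Localizer

end Localizer

/-! ### The kernel theorem -/

section KernelTheorem

open Filter

theorem LinearMap.continuous_of_norm_le_seminorm {𝕜 𝕂 E : Type*} [RCLike 𝕜] [RCLike 𝕂]
    [NormedAlgebra 𝕜 𝕂] [AddCommGroup E] [Module 𝕜 E] [TopologicalSpace E] [IsTopologicalAddGroup E]
    (u : E →ₗ[𝕜] 𝕂) {q : Seminorm 𝕜 E} (hq : Continuous q) {C : ℝ} (h : ∀ x, ‖u x‖ ≤ C * q x) :
    Continuous u := by
  refine continuous_of_continuousAt_zero u ?_
  rw [ContinuousAt, map_zero]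
  refine squeeze_zero_norm h ?_
  simpa using (hq.tendsto 0).const_mul C

/-- Expand `T (w + (v - w))`: every term other than `T w` has some entry `v i - w i`, hence bound
zero. -/
theorem MultilinearMap.eq_of_seminorm_sub_eq_zero {𝕜 𝕂 E : Type*} [RCLike 𝕜] [RCLike 𝕂]
    [NormedAlgebra 𝕜 𝕂] [AddCommGroup E] [Module 𝕜 E] {k : ℕ}
    (T : MultilinearMap 𝕜 (fun _ : Fin k => E) 𝕂) {p : Seminorm 𝕜 E} {C : ℝ}
    (hT : ∀ v, ‖T v‖ ≤ C * ∏ i, p (v i)) {v w : Fin k → E} (h : ∀ i, p (v i - w i) = 0) :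
    T v = T w := by
  classical
  have hv : v = w + (v - w) := by abel
  rw [hv, T.map_add_univ, Finset.sum_eq_single Finset.univ]
  · rw [Finset.piecewise_univ]
  · intro s _ hs
    obtain ⟨i, hi⟩ : ∃ i, i ∉ s := by
      by_contra! hcon
      exact hs (Finset.eq_univ_of_forall hcon)
    refine norm_le_zero_iff.1 ((hT _).trans (le_of_eq ?_))
    rw [Finset.prod_eq_zero (Finset.mem_univ i), mul_zero]
    rw [Finset.piecewise_eq_of_notMem _ _ _ hi]
    exact h i
  · simp

variable {𝕜 : Type*} [RCLike 𝕜] {𝕂 : Type*} [RCLike 𝕂] [NormedAlgebra 𝕜 𝕂]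
  {V : Type*} [NormedAddCommGroup V] [NormedSpace ℝ V] {H : Type*} [TopologicalSpace H]
  {I : ModelWithCorners ℝ V H} {M : Type*} [TopologicalSpace M] [ChartedSpace H M]
  {ι : Type*} [Fintype ι] [IsManifold I ∞ M] [I.Boundaryless] {k : ℕ}

theorem Localizer.exists_sumSeminorm_basis_le {A : Type*} [Fintype A] (Λ : A → Localizer I M ι)
    (s : Finset (ChartCompact I M)) (m : ℕ) : ∃ D : ℝ, 0 ≤ D ∧ ∀ (a : A) (n : ι → ℕ),
      sumSeminorm 𝕜 s m ((Λ a).basis 𝕜 n) ≤ D * freqWeight n ^ m := by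
  choose D hD0 hD using fun a c => (Λ a).exists_chartSeminorm_basis_le (𝕜 := 𝕜) c m
  refine ⟨∑ a, ∑ c ∈ s, D a c, Finset.sum_nonneg fun a _ => Finset.sum_nonneg fun c _ => hD0 a c,
    fun a n => ?_⟩
  rw [sumSeminorm_apply]
  calc ∑ c ∈ s, chartSeminorm c m ((Λ a).basis 𝕜 n) ≤ ∑ c ∈ s, D a c * freqWeight n ^ m :=
        Finset.sum_le_sum fun c _ => hD a c n
    _ = (∑ c ∈ s, D a c) * freqWeight n ^ m := by rw [Finset.sum_mul]
    _ ≤ _ := mul_le_mul_of_nonneg_right (Finset.single_le_sum (f := fun a => ∑ c ∈ s, D a c)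
        (fun a _ => Finset.sum_nonneg fun c _ => hD0 a c) (Finset.mem_univ a))
        (pow_nonneg (freqWeight_pos n).le _)

theorem freqWeight_curry_le (n : Fin k × ι → ℕ) (i : Fin k) :
    freqWeight (fun j => n (i, j)) ≤ freqWeight n := by
  unfold freqWeight
  rw [Fintype.sum_prod_type]
  exact add_le_add le_rfl (Finset.single_le_sum (f := fun i => ∑ j, (n (i, j) : ℝ))
    (fun i _ => Finset.sum_nonneg fun j _ => Nat.cast_nonneg _) (Finset.mem_univ i))

/-- The order of the kernel of a `k`-linear form bounded by `C^m`-seminorms. -/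
def kernelOrder (k m d : ℕ) : ℕ := 2 * (k * m + k * d)

variable {A : Type*} [Fintype A] (Λ : A → Localizer I M ι)
  (T : MultilinearMap 𝕜 (fun _ : Fin k => SmoothFn 𝕜 I M) 𝕂)

/-- The terms of the series which defines the kernel of `T`. -/
def kernelTerm (a : Fin k → A) (n : Fin k × ι → ℕ)
    (ψ : SmoothFn 𝕜 (ModelWithCorners.pi fun _ : Fin k => I) (Fin k → M)) : 𝕂 :=
  (Localizer.pi fun i => Λ (a i)).coeff n ψ • T fun i => (Λ (a i)).basis 𝕜 fun j => n (i, j)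

variable {s : Finset (ChartCompact I M)} {m : ℕ} {C : ℝ}

/-- The decay of the coefficients beats the growth of `T` on the basis, uniformly in the frequency.
The number of derivatives of `ψ` used does not depend on `T`. -/
theorem exists_norm_kernelTerm_le (hC : 0 ≤ C) (hT : ∀ v, ‖T v‖ ≤ C * ∏ i, sumSeminorm 𝕜 s m (v i)) :
    ∃ D : ℝ, 0 ≤ D ∧ ∀ (a : Fin k → A) n ψ, ‖kernelTerm Λ T a n ψ‖ ≤
      D * chartSeminorm (Localizer.pi fun i => Λ (a i)).chartCompact
        (kernelOrder k m (Fintype.card ι)) ψ *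
        (freqWeight n ^ (2 * Fintype.card (Fin k × ι)))⁻¹ := by
  obtain ⟨D, hD0, hD⟩ := Localizer.exists_sumSeminorm_basis_le (𝕜 := 𝕜) Λ s m
  choose E hE0 hE using fun a : Fin k → A =>
    (Localizer.pi fun i => Λ (a i)).exists_norm_coeff_le (𝕜 := 𝕜)
      (k * m + k * Fintype.card ι)
  refine ⟨(∑ a, E a) * (C * D ^ k), mul_nonneg (Finset.sum_nonneg fun a _ => hE0 a) (by positivity),
    fun a n ψ => ?_⟩
  have hW := freqWeight_pos n
  have h1 : ‖T fun i => (Λ (a i)).basis 𝕜 fun j => n (i, j)‖ ≤ C * D ^ k * freqWeight n ^ (k * m) := by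
    refine (hT _).trans ?_
    rw [mul_assoc]
    refine mul_le_mul_of_nonneg_left ?_ hC
    calc ∏ i, sumSeminorm 𝕜 s m ((Λ (a i)).basis 𝕜 fun j => n (i, j))
        ≤ (D * freqWeight n ^ m) ^ Fintype.card (Fin k) :=
          prod_univ_le_pow_card (fun i => apply_nonneg _ _) fun i => (hD (a i) _).trans
            (mul_le_mul_of_nonneg_left (pow_le_pow_left₀ (freqWeight_pos _).le
              (freqWeight_curry_le n i) _) hD0)
      _ = _ := by rw [Fintype.card_fin, mul_pow, ← pow_mul, mul_comm m]
  rw [kernelTerm, norm_smul]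
  refine (mul_le_mul (hE a ψ n) h1 (norm_nonneg _) ?_).trans ?_
  · exact div_nonneg (mul_nonneg (hE0 a) (apply_nonneg _ _)) (pow_nonneg hW.le _)
  · set π := chartSeminorm (Localizer.pi fun i => Λ (a i)).chartCompact
        (kernelOrder k m (Fintype.card ι)) ψ with hπ
    have hπ0 : 0 ≤ π := apply_nonneg _ _
    have hEle : E a ≤ ∑ a, E a := Finset.single_le_sum (f := E) (fun a _ => hE0 a) (Finset.mem_univ a)
    -- This fixes `kernelOrder`: `k * m` is the growth of `T` on products of `k` basis functions,
    -- and the exponent `2 * (k * card ι)` must be left over for summability on `Fin k × ι`.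
    have hpow : freqWeight n ^ (k * m) / freqWeight n ^ (2 * (k * m + k * Fintype.card ι)) ≤
        (freqWeight n ^ (2 * Fintype.card (Fin k × ι)))⁻¹ := by
      rw [div_le_iff₀ (by positivity), inv_mul_eq_div, le_div_iff₀ (by positivity), ← pow_add,
        Fintype.card_prod, Fintype.card_fin]
      exact pow_le_pow_right₀ (one_le_freqWeight n) (by nlinarith [Nat.zero_le (k * m)])
    calc E a * π / freqWeight n ^ (2 * (k * m + k * Fintype.card ι)) *
          (C * D ^ k * freqWeight n ^ (k * m))
        = E a * (π * (C * D ^ k) * (freqWeight n ^ (k * m) /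
            freqWeight n ^ (2 * (k * m + k * Fintype.card ι)))) := by ring
      _ ≤ (∑ a, E a) * (π * (C * D ^ k) * (freqWeight n ^ (2 * Fintype.card (Fin k × ι)))⁻¹) :=
          mul_le_mul hEle (mul_le_mul_of_nonneg_left hpow (by positivity)) (by positivity)
            ((hE0 a).trans hEle)
      _ = _ := by ring

/-- The kernel of `T`, as a linear form. -/
def kernelLinear (hsum : ∀ (a : Fin k → A) ψ, Summable fun n => kernelTerm Λ T a n ψ) :
    SmoothFn 𝕜 (ModelWithCorners.pi fun _ : Fin k => I) (Fin k → M) →ₗ[𝕜] 𝕂 where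
  toFun ψ := ∑ a : Fin k → A, ∑' n, kernelTerm Λ T a n ψ
  map_add' ψ χ := by
    rw [← Finset.sum_add_distrib]
    refine Finset.sum_congr rfl fun a _ => ?_
    rw [← (hsum a ψ).tsum_add (hsum a χ)]
    refine tsum_congr fun n => ?_
    simp only [kernelTerm, map_add, add_smul]
  map_smul' c ψ := by
    rw [RingHom.id_apply, Finset.smul_sum]
    refine Finset.sum_congr rfl fun a _ => ?_
    rw [← (hsum a ψ).tsum_const_smul]
    refine tsum_congr fun n => ?_
    simp only [kernelTerm, map_smul, smul_assoc]

/-- Expand every `χ v i` in its cosine series and use continuity of `T`. Truncating all `k` series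
to the same finite set `S` gives the partial sum of the kernel series over the box `S^k`, since the
coefficients of a tensor factor. -/
theorem tsum_kernelTerm_tensor (hsum : ∀ (a : Fin k → A) ψ, Summable fun n => kernelTerm Λ T a n ψ)
    (hTc : Continuous T) (a : Fin k → A) (v : Fin k → SmoothFn 𝕜 I M) :
    ∑' n, kernelTerm Λ T a n (SmoothFn.tensor v) =
      T fun i => SmoothFn.mulReal (Λ (a i)).χ (Λ (a i)).smooth_χ (v i) := by
  classical
  have h1 : Tendsto (fun S : Finset (ι → ℕ) => T fun i => ∑ n ∈ S,
      (Λ (a i)).coeff n (v i) • (Λ (a i)).basis 𝕜 n) atTop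
      (𝓝 (T fun i => SmoothFn.mulReal (Λ (a i)).χ (Λ (a i)).smooth_χ (v i))) :=
    (hTc.tendsto _).comp (tendsto_pi_nhds.2 fun i => (Λ (a i)).hasSum_coeff_smul_basis (v i))
  let e : (Fin k → ι → ℕ) ≃ (Fin k × ι → ℕ) := (Equiv.curry (Fin k) ι ℕ).symm
  have h2 : Tendsto (fun S : Finset (ι → ℕ) => ∑ n ∈ Fintype.piFinset fun _ : Fin k => S,
      kernelTerm Λ T a (e n) (SmoothFn.tensor v)) atTop
      (𝓝 (∑' n, kernelTerm Λ T a n (SmoothFn.tensor v))) := by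
    have hs := e.hasSum_iff.2 (hsum a (SmoothFn.tensor v)).hasSum
    -- The boxes `S^k` exhaust the multi-indices, so the unconditional sum may be computed along
    -- them.
    refine hs.comp (tendsto_atTop_finset_of_monotone (fun S S' h => Fintype.piFinset_subset _ _
      fun _ => h) fun n => ⟨Finset.univ.image n, ?_⟩)
    exact Fintype.mem_piFinset.2 fun i => Finset.mem_image_of_mem _ (Finset.mem_univ i)
  refine tendsto_nhds_unique h2 (h1.congr fun S => ?_)
  rw [T.map_sum_finset]
  refine Finset.sum_congr rfl fun n _ => ?_
  rw [T.map_smul_univ, kernelTerm, Localizer.coeff_pi_tensor]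
  rfl

/-- **Kernel theorem**: a multilinear form which is bounded by products of given `C^m`-seminorms is
represented by a compactly supported distribution, with uniform bounds on its order and support. -/
theorem exists_kernel [FiniteDimensional ℝ V] [T2Space M] (L : V ≃L[ℝ] (ι → ℝ)) (k : ℕ)
    (s : Finset (ChartCompact I M)) (m : ℕ) :
    ∃ K : Set (Fin k → M), IsCompact K ∧
      ∀ (T : MultilinearMap 𝕜 (fun _ : Fin k => SmoothFn 𝕜 I M) 𝕂) (C : ℝ), 0 ≤ C → Continuous T →
        (∀ v, ‖T v‖ ≤ C * ∏ i, sumSeminorm 𝕜 s m (v i)) →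
        ∃ u : SmoothFn 𝕜 (ModelWithCorners.pi fun _ : Fin k => I) (Fin k → M) →L[𝕜] 𝕂,
          (∀ v, u (SmoothFn.tensor v) = T v) ∧
          HasOrderAtMost u (kernelOrder k m (Fintype.card ι)) ∧ distSupport u ⊆ K := by
  classical
  have hK₀ : IsCompact (⋃ c ∈ s, (extChartAt I c.pt).symm '' c.carrier) :=
    s.isCompact_biUnion fun c _ => c.isCompact.image_of_continuousOn
      ((continuousOn_extChartAt_symm c.pt).mono c.subset)
  obtain ⟨A, _, Λ, O, hO, hKO, hΛ⟩ := Localizer.exists_sum_χ_eq_one (I := I) L hK₀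
  -- The cut-offs, and hence this compact set, are chosen from `s` alone, before `T`; this makes the
  -- support uniform in `T`.
  refine ⟨⋃ a : Fin k → A, tsupport (Localizer.pi fun i => Λ (a i)).θ, isCompact_iUnion fun a =>
    (Localizer.pi fun i => Λ (a i)).isCompact_tsupport, fun T C hC hTc hT => ?_⟩
  obtain ⟨D, hD0, hD⟩ := exists_norm_kernelTerm_le Λ T hC hT
  have hZ := summable_freqWeight_inv_pow (ι := Fin k × ι)
  have hsum : ∀ (a : Fin k → A) ψ, Summable fun n => kernelTerm Λ T a n ψ := fun a ψ =>
    Summable.of_norm_bounded (hZ.mul_left _) (hD a · ψ)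
  set Z := ∑' n : Fin k × ι → ℕ, (freqWeight n ^ (2 * Fintype.card (Fin k × ι)))⁻¹
  have hZ0 : 0 ≤ Z := tsum_nonneg fun n => inv_nonneg.2 (pow_nonneg (freqWeight_pos n).le _)
  set ord := kernelOrder k m (Fintype.card ι)
  set s' := Finset.univ.image fun a : Fin k → A => (Localizer.pi fun i => Λ (a i)).chartCompact
  have hbound : ∀ ψ, ‖kernelLinear Λ T hsum ψ‖ ≤
      (∑ _a : Fin k → A, D * Z) * sumSeminorm 𝕜 s' ord ψ := by
    intro ψ
    rw [Finset.sum_mul]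
    refine norm_sum_le_of_le _ fun a _ => ?_
    have hle : chartSeminorm (Localizer.pi fun i => Λ (a i)).chartCompact ord ψ ≤
        sumSeminorm 𝕜 s' ord ψ := chartSeminorm_le_sumSeminorm
      (Finset.mem_image_of_mem (fun a : Fin k → A => (Localizer.pi fun i => Λ (a i)).chartCompact)
        (Finset.mem_univ a)) (le_refl ord) ψ
    refine (tsum_of_norm_bounded (hZ.mul_left _).hasSum (hD a · ψ)).trans ?_
    rw [tsum_mul_left, mul_right_comm]
    exact mul_le_mul_of_nonneg_left hle (mul_nonneg hD0 hZ0)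
  refine ⟨⟨kernelLinear Λ T hsum, LinearMap.continuous_of_norm_le_seminorm _
    (continuous_sumSeminorm s' ord) hbound⟩, fun v => ?_, ⟨s', ∑ _a : Fin k → A, D * Z,
      fun ψ => ?_⟩, fun x hx => ?_⟩
  -- Each `v i` agrees with `∑ a, χ_a v i` on a neighbourhood of the compact sets of `s`, and the
  -- bound on `T` makes it blind to the difference.
  · have hsub : T v = T fun i => ∑ a, SmoothFn.mulReal (Λ a).χ (Λ a).smooth_χ (v i) := by
      refine T.eq_of_seminorm_sub_eq_zero hT fun i => ?_
      rw [sumSeminorm_apply]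
      refine Finset.sum_eq_zero fun c hc => chartSeminorm_eq_zero hO
        ((Set.subset_biUnion_of_mem (u := fun c : ChartCompact I M =>
          (extChartAt I c.pt).symm '' c.carrier) hc).trans hKO) (fun x hx => ?_) m
      rw [← SmoothFn.eval_apply, map_sub, map_sum]
      simp only [SmoothFn.eval_apply, SmoothFn.mulReal_apply]
      rw [← Finset.sum_smul, hΛ x hx, one_smul, sub_self]
    rw [hsub, T.map_sum]
    exact Finset.sum_congr rfl fun a _ => tsum_kernelTerm_tensor Λ T hsum hTc a v
  · rw [← sumSeminorm_apply]
    exact hbound ψ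
  · by_contra hcon
    have hcl : IsClosed (⋃ a : Fin k → A, tsupport (Localizer.pi fun i => Λ (a i)).θ) :=
      isClosed_iUnion_of_finite fun a => isClosed_tsupport _
    obtain ⟨ψ, -, hψ, hu⟩ := hx _ hcl.isOpen_compl hcon
    refine hu (Finset.sum_eq_zero fun a _ => ?_)
    have : ∀ n, kernelTerm Λ T a n ψ = 0 := fun n => by
      rw [kernelTerm, Localizer.coeff_eq_zero, zero_smul]
      intro y hy
      exact image_eq_zero_of_notMem_tsupport fun h => hψ h (Set.mem_iUnion.2 ⟨a, hy⟩)
    simp [this]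

/-- A distribution on `M^k` which vanishes on all the tensor products is zero. -/
theorem eq_zero_of_forall_tensor_eq_zero [FiniteDimensional ℝ V] [T2Space M] (L : V ≃L[ℝ] (ι → ℝ))
    {u : SmoothFn 𝕜 (ModelWithCorners.pi fun _ : Fin k => I) (Fin k → M) →L[𝕜] 𝕂}
    (hu : ∀ v, u (SmoothFn.tensor v) = 0) : u = 0 := by
  classical
  obtain ⟨s, m, C, hC0, hC⟩ := SmoothFn.exists_le_sumSeminorm
    (p := (normSeminorm 𝕜 𝕂).comp u.toLinearMap) (u.continuous.norm)
  have hcomp : IsCompact (⋃ c ∈ s, (extChartAt (ModelWithCorners.pi fun _ : Fin k => I) c.pt).symm ''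
      c.carrier) :=
    s.isCompact_biUnion fun c _ => c.isCompact.image_of_continuousOn
      ((continuousOn_extChartAt_symm c.pt).mono c.subset)
  -- The seminorms bounding `u` live on a compact subset of `M^k`; its projections to the factors
  -- are compact, and one partition near their union serves all `k` variables.
  obtain ⟨A, _, Λ, O, hO, hKO, hΛ⟩ := Localizer.exists_sum_χ_eq_one (I := I) L
    (isCompact_iUnion fun i : Fin k => hcomp.image (continuous_apply i))
  ext ψ
  have h1 : ∀ a : Fin k → A, u (SmoothFn.mulReal _ (Localizer.pi fun i => Λ (a i)).smooth_χ ψ) = 0 := by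
    intro a
    have h := u.hasSum ((Localizer.pi fun i => Λ (a i)).hasSum_coeff_smul_basis ψ)
    refine h.unique ?_
    have h0 : ∀ n, u ((Localizer.pi fun i => Λ (a i)).coeff n ψ •
        (Localizer.pi fun i => Λ (a i)).basis 𝕜 n) = 0 := fun n => by
      rw [map_smul, Localizer.basis_pi, hu, smul_zero]
    simp only [h0]
    exact hasSum_zero
  have h2 : sumSeminorm 𝕜 s m (ψ - ∑ a : Fin k → A,
      SmoothFn.mulReal _ (Localizer.pi fun i => Λ (a i)).smooth_χ ψ) = 0 := by
    rw [sumSeminorm_apply]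
    refine Finset.sum_eq_zero fun c hc => chartSeminorm_eq_zero
      (O := Set.univ.pi fun _ => O) (isOpen_set_pi Set.finite_univ fun _ _ => hO) ?_ ?_ m
    · intro x hx i _
      exact hKO (Set.mem_iUnion.2 ⟨i, x, Set.mem_biUnion hc hx, rfl⟩)
    · intro x hx
      rw [← SmoothFn.eval_apply, map_sub, map_sum]
      simp only [SmoothFn.eval_apply, SmoothFn.mulReal_apply]
      -- The sum over `a` of the products of cut-offs factors as the product over `i` of the sums `∑
      -- a, χ_a (x i)`.
      have : ∑ a : Fin k → A, (Localizer.pi fun i => Λ (a i)).χ x = 1 := by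
        change ∑ a : Fin k → A, ∏ i, (Λ (a i)).χ (x i) = 1
        rw [← Fintype.prod_sum fun i a => (Λ a).χ (x i)]
        exact Finset.prod_eq_one fun i _ => hΛ _ (hx i trivial)
      rw [← Finset.sum_smul, this, one_smul, sub_self]
  have h3 := hC (ψ - ∑ a : Fin k → A,
      SmoothFn.mulReal _ (Localizer.pi fun i => Λ (a i)).smooth_χ ψ)
  rw [h2, mul_zero] at h3
  have h4 : u (ψ - ∑ a : Fin k → A,
      SmoothFn.mulReal _ (Localizer.pi fun i => Λ (a i)).smooth_χ ψ) = 0 := norm_le_zero_iff.1 h3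
  rw [map_sub, map_sum, Finset.sum_eq_zero fun a _ => h1 a, sub_zero] at h4
  exact h4

end KernelTheorem

/-! ### Local bounds of families of multilinear maps -/

section LocalBound

open Filter

variable {𝕜 : Type*} [RCLike 𝕜] {𝕂 : Type*} [RCLike 𝕂] [NormedAlgebra 𝕜 𝕂]
  {E : Type*} [AddCommGroup E] [Module 𝕜 E]

/-- Rescale each `v i` by `p (v i) + ε`; the `ε > 0` allows for `p (v i) = 0` and tends to zero at
the end. -/
theorem MultilinearMap.norm_le_prod_seminorm {k : ℕ} (T : MultilinearMap 𝕜 (fun _ : Fin k => E) 𝕂)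
    {p : Seminorm 𝕜 E} {R : ℝ} (h : ∀ v, (∀ i, p (v i) < 1) → ‖T v‖ ≤ R) (v : Fin k → E) :
    ‖T v‖ ≤ R * ∏ i, p (v i) := by
  have key : ∀ ε : ℝ, 0 < ε → ‖T v‖ ≤ R * ∏ i, (p (v i) + ε) := by
    intro ε hε
    have hc : ∀ i, 0 < p (v i) + ε := fun i => add_pos_of_nonneg_of_pos (apply_nonneg _ _) hε
    set c : Fin k → 𝕜 := fun i => ((p (v i) + ε : ℝ) : 𝕜)
    have hcn : ∀ i, ‖c i‖ = p (v i) + ε := fun i => RCLike.norm_of_nonneg (hc i).le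
    have hc0 : ∀ i, c i ≠ 0 := fun i => by
      rw [← norm_ne_zero_iff, hcn]; exact (hc i).ne'
    have hv : v = fun i => c i • ((c i)⁻¹ • v i) := by
      funext i; rw [smul_inv_smul₀ (hc0 i)]
    have hT : ‖T fun i => (c i)⁻¹ • v i‖ ≤ R := h _ fun i => by
      rw [map_smul_eq_mul, norm_inv, hcn, inv_mul_lt_one₀ (hc i)]
      exact lt_add_of_pos_right _ hε
    calc ‖T v‖ = (∏ i, (p (v i) + ε)) * ‖T fun i => (c i)⁻¹ • v i‖ := by
          conv_lhs => rw [hv]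
          rw [T.map_smul_univ, norm_smul, norm_prod]
          simp_rw [hcn]
      _ ≤ (∏ i, (p (v i) + ε)) * R :=
          mul_le_mul_of_nonneg_left hT (Finset.prod_nonneg fun i _ => (hc i).le)
      _ = _ := mul_comm _ _
  have hlim : Tendsto (fun ε : ℝ => R * ∏ i, (p (v i) + ε)) (𝓝[>] 0) (𝓝 (R * ∏ i, (p (v i) + 0))) :=
    (Continuous.tendsto (by fun_prop) 0).mono_left nhdsWithin_le_nhds
  simp only [add_zero] at hlim
  exact ge_of_tendsto hlim (eventually_mem_nhdsWithin.mono fun ε hε => key ε hε)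

variable [TopologicalSpace E]

theorem Seminorm.continuous_finset_sup {ι : Type*} {p : ι → Seminorm 𝕜 E}
    (hp : ∀ i, Continuous (p i)) (s : Finset ι) : Continuous ⇑(s.sup p : Seminorm 𝕜 E) := by
  classical
  induction s using Finset.induction_on with
  | empty => exact continuous_const
  | insert a s _ ih =>
    rw [Finset.sup_insert, Seminorm.coe_sup]
    exact (hp a).sup ih

theorem exists_seminorm_lt_one_subset [PolynormableSpace 𝕜 E] {W : Set E} (hW : W ∈ 𝓝 0) :
    ∃ p : Seminorm 𝕜 E, Continuous p ∧ ∀ x, p x < 1 → x ∈ W := by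
  obtain ⟨s, r, hr, hs⟩ := ((PolynormableSpace.withSeminorms 𝕜 E).mem_nhds_iff 0 W).1 hW
  set q : Seminorm 𝕜 E := s.sup fun p : {p : Seminorm 𝕜 E // Continuous p} => p.1
  have hq : Continuous q := Seminorm.continuous_finset_sup (fun p => p.2) s
  refine ⟨Real.toNNReal r⁻¹ • q, continuous_const.mul hq, fun x hx => hs ?_⟩
  have h : (Real.toNNReal r⁻¹ : ℝ) * q x < 1 := hx
  rw [Real.coe_toNNReal _ (inv_nonneg.2 hr.le), inv_mul_lt_one₀ hr] at h
  exact (Seminorm.mem_ball_zero _).2 h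

/-- A continuous family of multilinear maps is locally bounded by a product of seminorms. -/
theorem exists_seminorm_bound_of_continuousAt [PolynormableSpace 𝕜 E] {k : ℕ}
    {G : E → (Fin k → E) → 𝕂} {φ₀ : E}
    (hc : ContinuousAt (fun p : E × (Fin k → E) => G p.1 p.2) (φ₀, 0)) :
    ∃ V ∈ 𝓝 φ₀, ∃ (p : Seminorm 𝕜 E) (C : ℝ), Continuous p ∧ 0 < C ∧
      ∀ φ ∈ V, ∀ T : MultilinearMap 𝕜 (fun _ : Fin k => E) 𝕂, (∀ v, T v = G φ v) →
        ∀ v, ‖T v‖ ≤ C * ∏ i, p (v i) := by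
  have h : ∀ᶠ q : E × (Fin k → E) in 𝓝 φ₀ ×ˢ 𝓝 0, ‖G q.1 q.2‖ < ‖G φ₀ 0‖ + 1 := by
    rw [← nhds_prod_eq]
    exact hc.norm.eventually (gt_mem_nhds (lt_add_one _))
  obtain ⟨P, hP, Q, hQ, hPQ⟩ := eventually_prod_iff.1 h
  have hQ' : {v | Q v} ∈ 𝓝 (0 : Fin k → E) := hQ
  rw [nhds_pi, Filter.mem_pi'] at hQ'
  obtain ⟨I, t, ht, hI⟩ := hQ'
  obtain ⟨p, hp, hpW⟩ := exists_seminorm_lt_one_subset (𝕜 := 𝕜)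
    (W := ⋂ i, t i) ((Filter.iInter_mem).2 fun i => ht i)
  -- The term `‖G φ₀ 0‖` matters for `k = 0`, where a multilinear map need not vanish at `0`.
  refine ⟨{φ | P φ}, hP, p, ‖G φ₀ 0‖ + 1, hp, by positivity, fun φ hφ T hT v => ?_⟩
  refine T.norm_le_prod_seminorm (fun v hv => ?_) v
  rw [hT]
  exact (hPQ hφ (hI fun i _ => Set.mem_iInter.1 (hpW _ (hv i)) i)).le

end LocalBound

/-! ### Multilinearity of the Gâteaux differentials -/

section Bastiani

open Filter

variable {𝕜 : Type*} [RCLike 𝕜] {𝕂 : Type*} [RCLike 𝕂] [NormedAlgebra 𝕜 𝕂]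
  {E : Type*} [AddCommGroup E] [Module 𝕜 E] [TopologicalSpace E] {U : Set E} {F : E → 𝕂}

theorem gateauxDiff_continuousOn (hF : BastianiSmoothOn 𝕜 F U) (k : ℕ) (v : Fin k → E) :
    ContinuousOn (fun x => gateauxDiff 𝕜 F k x v) U :=
  (hF k).2.comp (f := fun x => (x, v)) (by fun_prop) fun x hx => ⟨hx, trivial⟩

theorem gateauxDiff_lineDifferentiableAt (hF : BastianiSmoothOn 𝕜 F U) (k : ℕ) {x : E} (hx : x ∈ U)
    (v : Fin k → E) (w : E) : LineDifferentiableAt 𝕜 (fun y => gateauxDiff 𝕜 F k y v) x w := by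
  have := (hF (k + 1)).1 k (Nat.lt_succ_self k) x hx (Fin.cons w v)
  simpa using this

variable [IsTopologicalAddGroup E] [ContinuousSMul 𝕜 E]

theorem eventually_add_smul_mem (hU : IsOpen U) {x : E} (hx : x ∈ U) (v : E) :
    ∀ᶠ t : 𝕜 in 𝓝 0, x + t • v ∈ U := by
  have : Continuous fun t : 𝕜 => x + t • v := by fun_prop
  refine this.continuousAt.preimage_mem_nhds (hU.mem_nhds ?_)
  simpa using hx

/-- On the plane `x + s v + t w` the function `G` has continuous partial derivatives, so it is
strictly differentiable at the origin; the chain rule along the diagonal `s = t` gives the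
derivative in direction `v + w`. -/
theorem lineDeriv_add_of_continuousOn (hU : IsOpen U) {G : E → 𝕂}
    (hd : ∀ x ∈ U, ∀ v, LineDifferentiableAt 𝕜 G x v)
    (hc : ∀ v, ContinuousOn (fun x => lineDeriv 𝕜 G x v) U) {x : E} (hx : x ∈ U) (v w : E) :
    lineDeriv 𝕜 G x (v + w) = lineDeriv 𝕜 G x v + lineDeriv 𝕜 G x w := by
  let c : 𝕜 × 𝕜 → E := fun q => x + (q.1 • v + q.2 • w)
  have hcc : Continuous c := by fun_prop
  have hc0 : c (0, 0) = x := by simp [c]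
  have hcU : ∀ᶠ q in 𝓝 ((0 : 𝕜), (0 : 𝕜)), c q ∈ U :=
    hcc.continuousAt.preimage_mem_nhds (hU.mem_nhds (by rw [hc0]; exact hx))
  -- A line derivative is taken at parameter `0`; moving the base point along the line gives the
  -- derivative at any parameter `s`.
  have hshift : ∀ (y : E) (a : E) (s : 𝕜), y + s • a ∈ U →
      HasDerivAt (fun s => G (y + s • a)) (lineDeriv 𝕜 G (y + s • a) a) s := by
    intro y a s hs
    have h := (hd _ hs a).hasLineDerivAt
    unfold HasLineDerivAt at h
    have h' := HasDerivAt.comp_sub_const (x := s) (a := s) (f := fun t => G (y + s • a + t • a))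
      (by rwa [sub_self])
    refine h'.congr_of_eventuallyEq (Eventually.of_forall fun t => ?_)
    change G (y + t • a) = G (y + s • a + (t - s) • a)
    rw [add_assoc, ← add_smul, add_sub_cancel]
  have key := hasStrictFDerivAt_uncurry_coprod (𝕜 := 𝕜) (u := ((0 : 𝕜), (0 : 𝕜)))
    (f := fun s t => G (c (s, t)))
    (f₁ := fun s t => ContinuousLinearMap.toSpanSingleton 𝕜 (lineDeriv 𝕜 G (c (s, t)) v))
    (f₂ := fun s t => ContinuousLinearMap.toSpanSingleton 𝕜 (lineDeriv 𝕜 G (c (s, t)) w))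
    (by
      filter_upwards [hcU] with q hq
      have h1 : ∀ s : 𝕜, c (s, q.2) = (x + q.2 • w) + s • v := fun s => by simp only [c]; abel
      have := hshift (x + q.2 • w) v q.1 (by rw [← h1]; exact hq)
      simp_rw [← h1] at this
      exact this.hasFDerivAt)
    (by
      filter_upwards [hcU] with q hq
      have h1 : ∀ s : 𝕜, c (q.1, s) = (x + q.1 • v) + s • w := fun s => by simp only [c]; abel
      have := hshift (x + q.1 • v) w q.2 (by rw [← h1]; exact hq)
      simp_rw [← h1] at this
      exact this.hasFDerivAt)
    (by
      have h1 : ContinuousAt (fun q => lineDeriv 𝕜 G (c q) v) (0, 0) :=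
        ContinuousAt.comp (f := c) (g := fun y => lineDeriv 𝕜 G y v)
          (((hc v).continuousAt (hU.mem_nhds (by rw [hc0]; exact hx)))) hcc.continuousAt
      exact (ContinuousLinearMap.toSpanSingletonCLE (𝕜 := 𝕜) (E := 𝕂)).continuous.continuousAt.comp h1)
    (by
      have h1 : ContinuousAt (fun q => lineDeriv 𝕜 G (c q) w) (0, 0) :=
        ContinuousAt.comp (f := c) (g := fun y => lineDeriv 𝕜 G y w)
          (((hc w).continuousAt (hU.mem_nhds (by rw [hc0]; exact hx)))) hcc.continuousAt
      exact (ContinuousLinearMap.toSpanSingletonCLE (𝕜 := 𝕜) (E := 𝕂)).continuous.continuousAt.comp h1)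
  have hdiag : HasDerivAt (fun t : 𝕜 => (t, t)) ((1 : 𝕜), (1 : 𝕜)) 0 :=
    (hasDerivAt_id 0).prodMk (hasDerivAt_id 0)
  have hfin := HasFDerivAt.comp_hasDerivAt (f := fun t : 𝕜 => (t, t)) (0 : 𝕜) key.hasFDerivAt hdiag
  have hline : HasLineDerivAt 𝕜 G (lineDeriv 𝕜 G x v + lineDeriv 𝕜 G x w) x (v + w) := by
    unfold HasLineDerivAt
    refine (hfin.congr_of_eventuallyEq (Eventually.of_forall fun t => ?_)).congr_deriv ?_
    · change G (x + t • (v + w)) = G (x + (t • v + t • w))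
      rw [smul_add]
    · simp [Function.HasUncurry.uncurry, hc0]
  exact hline.lineDeriv

theorem lineDeriv_congr_of_eqOn (hU : IsOpen U) {G G' : E → 𝕂} (h : Set.EqOn G G' U) {x : E}
    (hx : x ∈ U) (w : E) : lineDeriv 𝕜 G x w = lineDeriv 𝕜 G' x w :=
  Filter.EventuallyEq.deriv_eq ((eventually_add_smul_mem hU hx w).mono fun _ ht => h ht)

/-- Slot `0` is the outermost differentiation, additive by `lineDeriv_add_of_continuousOn`. For the
other slots, the identity for `k` holds on all of the open set `U` and may be differentiated in the
direction `v 0`. -/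
theorem gateauxDiff_update (hU : IsOpen U) (hF : BastianiSmoothOn 𝕜 F U) (k : ℕ) :
    ∀ x ∈ U, ∀ (v : Fin k → E) (i : Fin k) (a b : E),
      gateauxDiff 𝕜 F k x (Function.update v i (a + b)) =
        gateauxDiff 𝕜 F k x (Function.update v i a) + gateauxDiff 𝕜 F k x (Function.update v i b) ∧
      ∀ c : 𝕜, gateauxDiff 𝕜 F k x (Function.update v i (c • a)) =
        c • gateauxDiff 𝕜 F k x (Function.update v i a) := by
  induction k with
  | zero => exact fun x _ v i => i.elim0
  | succ k ih =>
    intro x hx v i a b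
    refine Fin.cases ?_ (fun j => ?_) i
    · simp only [gateauxDiff, Fin.tail_update_zero, Function.update_self]
      refine ⟨lineDeriv_add_of_continuousOn hU
        (fun y hy w => gateauxDiff_lineDifferentiableAt hF k hy _ w) (fun w => ?_) hx a b,
        fun c => lineDeriv_smul⟩
      have := gateauxDiff_continuousOn hF (k + 1) (Fin.cons w (Fin.tail v))
      simpa [gateauxDiff] using this
    · simp only [gateauxDiff, Fin.tail_update_succ]
      have h0 : ∀ a, Function.update v j.succ a 0 = v 0 := fun a =>
        Function.update_of_ne (Fin.succ_ne_zero j).symm _ _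
      simp only [h0]
      have hdiff := fun a => (gateauxDiff_lineDifferentiableAt hF k hx
        (Function.update (Fin.tail v) j a) (v 0)).hasLineDerivAt
      refine ⟨?_, fun c => ?_⟩
      · rw [lineDeriv_congr_of_eqOn hU (fun y hy => (ih y hy (Fin.tail v) j a b).1) hx]
        exact (HasDerivAt.add (hdiff a) (hdiff b)).deriv
      · rw [lineDeriv_congr_of_eqOn hU (fun y hy => (ih y hy (Fin.tail v) j a b).2 c) hx]
        exact (HasDerivAt.const_smul c (hdiff a)).deriv

/-- The Gâteaux differential of a smooth functional, as a multilinear map. -/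
def gateauxMultilinear (hU : IsOpen U) (hF : BastianiSmoothOn 𝕜 F U) (k : ℕ) {x : E} (hx : x ∈ U) :
    MultilinearMap 𝕜 (fun _ : Fin k => E) 𝕂 :=
  MultilinearMap.mk' (gateauxDiff 𝕜 F k x) (fun v i a b => (gateauxDiff_update hU hF k x hx v i a b).1)
    fun v i c a => (gateauxDiff_update hU hF k x hx v i a 0).2 c

end Bastiani

/-! ### Extension of multilinear maps to the completed projective tensor power -/

section CompletedTensor

open UniformSpace

variable {𝕜 : Type*} [RCLike 𝕜] {𝕂 : Type*} [RCLike 𝕂] [NormedAlgebra 𝕜 𝕂]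
  {E : Type*} [AddCommGroup E] [Module 𝕜 E] {k : ℕ}

/-- The triangle inequality applies to each representation of `ψ`, hence to the infimum over all of
them. -/
theorem PiTensorProduct.norm_lift_le_projSeminorm (T : MultilinearMap 𝕜 (fun _ : Fin k => E) 𝕂)
    {p : Fin k → Seminorm 𝕜 E} {C : ℝ} (hC : 0 ≤ C) (hT : ∀ v, ‖T v‖ ≤ C * ∏ i, p i (v i))
    (ψ : ⨂[𝕜] _ : Fin k, E) : ‖PiTensorProduct.lift T ψ‖ ≤ C * projSeminorm p ψ := by
  change _ ≤ C * ⨅ r : PiTensorProduct.lifts ψ, tensorCost p r.1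
  rw [Real.mul_iInf_of_nonneg hC]
  refine le_ciInf fun ⟨r, hr⟩ => ?_
  change _ ≤ C * tensorCost p r
  rw [← (PiTensorProduct.mem_lifts_iff ψ r).1 hr, tensorCost]
  clear hr
  generalize r.toList = l
  induction l with
  | nil => simp
  | cons a l ih =>
    simp only [List.map_cons, List.sum_cons, map_add, map_smul, PiTensorProduct.lift.tprod, mul_add]
    refine (norm_add_le _ _).trans (add_le_add ?_ ih)
    rw [norm_smul, mul_left_comm]
    exact mul_le_mul_of_nonneg_left (hT a.2) (norm_nonneg _)

/-- The linear map on the tensor power induced by a multilinear map. -/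
def ProjTensor.lift (T : MultilinearMap 𝕜 (fun _ : Fin k => E) 𝕂) : ProjTensor 𝕜 E k →ₗ[𝕜] 𝕂 :=
  PiTensorProduct.lift T ∘ₗ (ProjTensor.toTensor 𝕜 E k).toLinearMap

variable [TopologicalSpace E]

theorem ProjTensor.uniformContinuous_seminorm {p : Fin k → Seminorm 𝕜 E}
    (hp : ∀ i, Continuous (p i)) : UniformContinuous (ProjTensor.seminorm p) := by
  refine uniformContinuous_iInf_dom (i := fun i => ⟨p i, hp i⟩) ?_
  let _ : SeminormedAddCommGroup (ProjTensor 𝕜 E k) :=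
    (ProjTensor.seminorm p).toSeminormedAddCommGroup
  exact uniformContinuous_norm

/-- The extension to the completion of a uniformly continuous seminorm. -/
def ProjTensor.completionSeminorm (q : Seminorm 𝕜 (ProjTensor 𝕜 E k)) (hq : UniformContinuous q) :
    Seminorm 𝕜 (CompletedTensor 𝕜 E k) :=
  Seminorm.of (Completion.extension q)
    (fun x y => by
      have hc : Continuous (Completion.extension q) := Completion.continuous_extension
      induction x, y using Completion.induction_on₂ with
      | hp => exact isClosed_le (hc.comp continuous_add) (by fun_prop)
      | ih a b =>
        rw [← Completion.coe_add]
        simp only [Completion.extension_coe hq]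
        exact map_add_le_add q a b)
    (fun c x => by
      have hc : Continuous (Completion.extension q) := Completion.continuous_extension
      induction x using Completion.induction_on with
      | hp => exact isClosed_eq (hc.comp (continuous_const_smul c)) (by fun_prop)
      | ih a =>
        rw [← Completion.coe_smul]
        simp only [Completion.extension_coe hq]
        exact map_smul_eq_mul q c a)

theorem ProjTensor.continuous_completionSeminorm (q : Seminorm 𝕜 (ProjTensor 𝕜 E k))
    (hq : UniformContinuous q) : Continuous (ProjTensor.completionSeminorm q hq) :=
  Completion.continuous_extension

theorem ProjTensor.completionSeminorm_coe (q : Seminorm 𝕜 (ProjTensor 𝕜 E k))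
    (hq : UniformContinuous q) (x : ProjTensor 𝕜 E k) :
    ProjTensor.completionSeminorm q hq (x : CompletedTensor 𝕜 E k) = q x :=
  Completion.extension_coe hq x

/-- Elementary tensors span the algebraic tensor power, which is dense in the completion. -/
theorem CompletedTensor.ext {L L' : CompletedTensor 𝕜 E k →L[𝕜] 𝕂}
    (h : ∀ e : Fin k → E, L (completedTprod e) = L' (completedTprod e)) : L = L' := by
  let c : ProjTensor 𝕜 E k →ₗ[𝕜] CompletedTensor 𝕜 E k :=
    { toFun := Completion.coe'
      map_add' := Completion.coe_add
      map_smul' := Completion.coe_smul }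
  have key : (L.toLinearMap ∘ₗ c ∘ₗ (ProjTensor.toTensor 𝕜 E k).symm.toLinearMap) =
      L'.toLinearMap ∘ₗ c ∘ₗ (ProjTensor.toTensor 𝕜 E k).symm.toLinearMap :=
    PiTensorProduct.ext (MultilinearMap.ext h)
  ext x
  induction x using Completion.induction_on with
  | hp => exact isClosed_eq L.continuous L'.continuous
  | ih a => exact LinearMap.congr_fun key (ProjTensor.toTensor 𝕜 E k a)

/-- A multilinear map bounded by a product of continuous seminorms extends to the completed
projective tensor power. -/
theorem CompletedTensor.exists_extension (T : MultilinearMap 𝕜 (fun _ : Fin k => E) 𝕂)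
    {p : Fin k → Seminorm 𝕜 E} (hp : ∀ i, Continuous (p i)) {C : ℝ} (hC : 0 ≤ C)
    (hT : ∀ v, ‖T v‖ ≤ C * ∏ i, p i (v i)) :
    ∃ L : CompletedTensor 𝕜 E k →L[𝕜] 𝕂, (∀ e, L (completedTprod e) = T e) ∧
      ∀ ψ, ‖L ψ‖ ≤ C * ProjTensor.completionSeminorm _ (ProjTensor.uniformContinuous_seminorm hp) ψ := by
  have hb : ∀ x, ‖ProjTensor.lift T x‖ ≤ C * ProjTensor.seminorm p x := fun x =>
    PiTensorProduct.norm_lift_le_projSeminorm T hC hT _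
  let f : ProjTensor 𝕜 E k →L[𝕜] 𝕂 := ⟨ProjTensor.lift T, LinearMap.continuous_of_norm_le_seminorm _
    (ProjTensor.uniformContinuous_seminorm hp).continuous hb⟩
  let c : ProjTensor 𝕜 E k →L[𝕜] CompletedTensor 𝕜 E k :=
    { toFun := Completion.coe'
      map_add' := Completion.coe_add
      map_smul' := Completion.coe_smul
      cont := Completion.continuous_coe _ }
  have hext : ∀ x : ProjTensor 𝕜 E k, f.extend c (x : CompletedTensor 𝕜 E k) = ProjTensor.lift T x :=
    f.extend_eq (e := c) Completion.denseRange_coe (Completion.isUniformInducing_coe _)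
  refine ⟨f.extend c, fun e => ?_, fun ψ => ?_⟩
  · rw [completedTprod, hext]
    exact PiTensorProduct.lift.tprod e
  · induction ψ using Completion.induction_on with
    | hp =>
      exact isClosed_le (f.extend c).continuous.norm
        (continuous_const.mul (ProjTensor.continuous_completionSeminorm _ _))
    | ih a =>
      rw [hext, ProjTensor.completionSeminorm_coe]
      exact hb a

end CompletedTensor

/-! ### The two assertions of the theorem -/

/-- A continuous family of multilinear maps extends to an equicontinuous family of linear maps on
the completed projective tensor power. -/
theorem exists_extension_completedTensor {𝕜 : Type*} [RCLike 𝕜] {𝕂 : Type*} [RCLike 𝕂]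
    [NormedAlgebra 𝕜 𝕂] {E : Type*} [AddCommGroup E] [Module 𝕜 E] [TopologicalSpace E]
    [PolynormableSpace 𝕜 E] {k : ℕ} {U : Set E} (hU : IsOpen U)
    {F : E → MultilinearMap 𝕜 (fun _ : Fin k => E) 𝕂}
    (hF : ContinuousOn (fun p : E × (Fin k → E) => F p.1 p.2) (U ×ˢ Set.univ)) :
    ∃ Fbar : U → CompletedTensor 𝕜 E k →L[𝕜] 𝕂,
      (∀ (φ : U) (L : CompletedTensor 𝕜 E k →L[𝕜] 𝕂),
        (∀ e : Fin k → E, L (completedTprod e) = F φ e) ↔ L = Fbar φ) ∧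
      ∀ φ₀ : U, ∃ V ∈ 𝓝 φ₀, ∃ q : Seminorm 𝕜 (CompletedTensor 𝕜 E k), Continuous q ∧
        ∃ C : ℝ, 0 < C ∧ ∀ φ ∈ V, ∀ ψ : CompletedTensor 𝕜 E k,
          ‖Fbar φ ψ - Fbar φ₀ ψ‖ ≤ C * q ψ := by
  have hloc : ∀ φ₀ : U, ∃ V ∈ 𝓝 (φ₀ : E), ∃ (p : Seminorm 𝕜 E) (C : ℝ), Continuous p ∧ 0 < C ∧
      ∀ φ ∈ V, ∀ v, ‖F φ v‖ ≤ C * ∏ i, p (v i) := fun φ₀ => by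
    obtain ⟨V, hV, p, C, hp, hC, h⟩ := exists_seminorm_bound_of_continuousAt (𝕜 := 𝕜)
      (G := fun φ v => F φ v) (hF.continuousAt (x := ((φ₀ : E), 0))
        ((hU.prod isOpen_univ).mem_nhds ⟨φ₀.2, trivial⟩))
    exact ⟨V, hV, p, C, hp, hC, fun φ hφ => h φ hφ (F φ) fun _ => rfl⟩
  have hex : ∀ φ : U, ∃ L : CompletedTensor 𝕜 E k →L[𝕜] 𝕂, ∀ e, L (completedTprod e) = F φ e :=
    fun φ => by
      obtain ⟨V, hV, p, C, hp, hC, h⟩ := hloc φ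
      obtain ⟨L, hL, -⟩ := CompletedTensor.exists_extension (F φ) (fun _ => hp) hC.le
        (h φ (mem_of_mem_nhds hV))
      exact ⟨L, hL⟩
  choose Fbar hFbar using hex
  refine ⟨Fbar, fun φ L => ⟨fun hL => CompletedTensor.ext fun e => by rw [hL, hFbar],
    fun hL => hL ▸ hFbar φ⟩, fun φ₀ => ?_⟩
  obtain ⟨V, hV, p, C, hp, hC, h⟩ := hloc φ₀
  refine ⟨Subtype.val ⁻¹' V, continuous_subtype_val.continuousAt.preimage_mem_nhds hV, _,
    ProjTensor.continuous_completionSeminorm _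
      (ProjTensor.uniformContinuous_seminorm (k := k) fun _ => hp), C + C, by positivity, ?_⟩
  -- By uniqueness, `Fbar φ` is the extension built from the bound valid near `φ₀`, so it inherits a
  -- seminorm and a constant independent of `φ`.
  have hb : ∀ φ : U, (φ : E) ∈ V → ∀ ψ, ‖Fbar φ ψ‖ ≤ C * ProjTensor.completionSeminorm _
      (ProjTensor.uniformContinuous_seminorm (k := k) fun _ => hp) ψ := fun φ hφ => by
    obtain ⟨L, hL, hLb⟩ := CompletedTensor.exists_extension (F φ) (fun _ => hp) hC.le (h φ hφ)
    rwa [CompletedTensor.ext (L := Fbar φ) (L' := L) fun e => by rw [hL, hFbar]]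
  intro φ hφ ψ
  rw [add_mul]
  exact (norm_sub_le _ _).trans (add_le_add (hb φ hφ ψ) (hb φ₀ (mem_of_mem_nhds hV) ψ))

/-- The derivatives of a smooth functional have locally a bounded order and a common compact
support. -/
theorem exists_derivKernel {𝕜 : Type*} [RCLike 𝕜] {𝕂 : Type*} [RCLike 𝕂] [NormedAlgebra 𝕜 𝕂]
    {V : Type*} [NormedAddCommGroup V] [NormedSpace ℝ V] [FiniteDimensional ℝ V]
    {ι : Type*} [Fintype ι] (L : V ≃L[ℝ] (ι → ℝ))
    {H : Type*} [TopologicalSpace H] {I : ModelWithCorners ℝ V H} [I.Boundaryless]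
    {M : Type*} [TopologicalSpace M] [ChartedSpace H M] [IsManifold I ∞ M] [T2Space M]
    {U : Set (SmoothFn 𝕜 I M)} (hU : IsOpen U) {F : SmoothFn 𝕜 I M → 𝕂}
    (hF : BastianiSmoothOn 𝕜 F U) {φ₀ : SmoothFn 𝕜 I M} (hφ₀ : φ₀ ∈ U) (k : ℕ) :
    ∃ W ∈ 𝓝 φ₀, W ⊆ U ∧ ∃ (m : ℕ) (K : Set (Fin k → M)), IsCompact K ∧
      ∀ φ ∈ W, ∃ u : SmoothFn 𝕜 (ModelWithCorners.pi fun _ : Fin k => I) (Fin k → M) →L[𝕜] 𝕂,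
        IsDerivKernel F k φ u ∧ (∀ u', IsDerivKernel F k φ u' → u' = u) ∧
        distOrder u ≤ m ∧ distSupport u ⊆ K := by
  have := (SmoothFn.withSeminorms (𝕜 := 𝕜) (I := I) (N := M)).toPolynormableSpace
  obtain ⟨W, hW, p, C, hp, hC, h⟩ := exists_seminorm_bound_of_continuousAt (𝕜 := 𝕜)
    (G := gateauxDiff 𝕜 F k) ((hF k).2.continuousAt (x := (φ₀, 0))
      ((hU.prod isOpen_univ).mem_nhds ⟨hφ₀, trivial⟩))
  -- `s`, `m` and `D` come from the seminorm `p`, which is common to all `φ` in `W`; hence so are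
  -- the order and the compact set obtained from `exists_kernel`. Replacing `p` in the `k` slots
  -- costs the factor `D ^ k`.
  obtain ⟨s, m, D, hD, hpD⟩ := SmoothFn.exists_le_sumSeminorm hp
  obtain ⟨K, hK, hker⟩ := exists_kernel (𝕜 := 𝕜) (𝕂 := 𝕂) L k s m
  refine ⟨W ∩ U, Filter.inter_mem hW (hU.mem_nhds hφ₀), Set.inter_subset_right,
    kernelOrder k m (Fintype.card ι), K, hK, fun φ hφ => ?_⟩
  obtain ⟨u, hu, hord, hsupp⟩ := hker (gateauxMultilinear hU hF k hφ.2) (C * D ^ k) (by positivity)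
    ((hF k).2.comp_continuous (f := fun v => (φ, v)) (by fun_prop) fun v => ⟨hφ.2, trivial⟩)
    fun v => by
      refine (h φ hφ.1 (gateauxMultilinear hU hF k hφ.2) (fun _ => rfl) v).trans ?_
      rw [mul_assoc]
      refine mul_le_mul_of_nonneg_left ?_ hC.le
      calc ∏ i, p (v i) ≤ ∏ i, D * sumSeminorm 𝕜 s m (v i) :=
            Finset.prod_le_prod (fun i _ => apply_nonneg _ _) fun i _ => hpD _
        _ = _ := by rw [Finset.prod_mul_distrib, Finset.prod_const, Finset.card_univ, Fintype.card_fin]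
  refine ⟨u, hu, fun u' hu' => sub_eq_zero.1 (eq_zero_of_forall_tensor_eq_zero L fun v => ?_),
    iInf₂_le _ hord, hsupp⟩
  rw [sub_apply, hu', hu]
  exact sub_self _

end

theorem mainTheorem6 {𝕜 : Type*} [RCLike 𝕜] {𝕂 : Type*} [RCLike 𝕂] [NormedAlgebra 𝕜 𝕂] :
    -- Equicontinuity: for a Fréchet space `E` and `F : U × E^k → 𝕂`, continuous and multilinear
    -- in the last `k` variables.
    (∀ (E : Type*) [AddCommGroup E] [Module 𝕜 E] [UniformSpace E] [IsUniformAddGroup E]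
      [ContinuousSMul 𝕜 E] [PolynormableSpace 𝕜 E] [T2Space E] [CompleteSpace E]
      [(uniformity E).IsCountablyGenerated]
      (k : ℕ) (U : Set E) (_ : IsOpen U)
      (F : E → MultilinearMap 𝕜 (fun _ : Fin k => E) 𝕂)
      (_ : ContinuousOn (fun p : E × (Fin k → E) => F p.1 p.2) (U ×ˢ Set.univ)),
      ∃ Fbar : U → CompletedTensor 𝕜 E k →L[𝕜] 𝕂,
        (∀ (φ : U) (L : CompletedTensor 𝕜 E k →L[𝕜] 𝕂),
          (∀ e : Fin k → E, L (completedTprod e) = F φ e) ↔ L = Fbar φ) ∧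
        ∀ φ₀ : U, ∃ V ∈ 𝓝 φ₀, ∃ q : Seminorm 𝕜 (CompletedTensor 𝕜 E k), Continuous q ∧
          ∃ C : ℝ, 0 < C ∧ ∀ φ ∈ V, ∀ ψ : CompletedTensor 𝕜 E k,
            ‖Fbar φ ψ - Fbar φ₀ ψ‖ ≤ C * q ψ) ∧
    -- Locally bounded order and locally uniform compact support of `F^{(k)}_φ`.
    (∀ (d : ℕ) (M : Type*) [TopologicalSpace M] [ChartedSpace (EuclideanSpace ℝ (Fin d)) M]
      [IsManifold (𝓡 d) ∞ M] [T2Space M] [ParacompactSpace M]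
      (U : Set (SmoothFn 𝕜 (𝓡 d) M)) (_ : IsOpen U)
      (F : SmoothFn 𝕜 (𝓡 d) M → 𝕂) (_ : BastianiSmoothOn 𝕜 F U)
      (φ₀ : SmoothFn 𝕜 (𝓡 d) M) (_ : φ₀ ∈ U) (k : ℕ),
      ∃ V ∈ 𝓝 φ₀, V ⊆ U ∧ ∃ (m : ℕ) (K : Set (Fin k → M)), IsCompact K ∧
        ∀ φ ∈ V, ∃ u : SmoothFn 𝕜 (ModelWithCorners.pi fun _ : Fin k => 𝓡 d) (Fin k → M) →L[𝕜] 𝕂,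
          IsDerivKernel F k φ u ∧ (∀ u', IsDerivKernel F k φ u' → u' = u) ∧
          distOrder u ≤ m ∧ distSupport u ⊆ K) := by
  exact ⟨fun E _ _ _ _ _ _ _ _ _ k U hU F hF => exists_extension_completedTensor hU hF,
    fun d M _ _ _ _ _ U hU F hF φ₀ hφ₀ k =>
      exists_derivKernel (EuclideanSpace.equiv (Fin d) ℝ) hU hF hφ₀ k⟩
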